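/- There are universal constants $c,C>0$ such that the following holds. Let $d_x,d_y\ge 1$, $n\ge 1$ be integers, let $A\in\mathbb{R}^{d_y\times d_x}$ have rank at most $r$, let $\Sigma\in\mathbb{R}^{d_x\times d_x}$ be symmetric positive definite, $\sigma>0$ and $\delta\in(0,1)$. Let $x_1,\dots,x_n$ be i.i.d. $\mathcal N(0,\Sigma)$ and, independently of them, let $\eta_1,\dots,\eta_n$ be i.i.d. $\mathcal N(0,\sigma^2 I_{d_y})$; put $y_i=Ax_i+\eta_i$, let $X\in\mathbb{R}^{n\times d_x}$ and $Y\in\mathbb{R}^{n\times d_y}$ be the matrices with rows $x_i$ and $y_i$, and let $\hat\Sigma=\frac1n X^\top X$. Write $s_1(M)\ge s_2(M)\ge\cdots$ for the singular values of a matrix $M$ and $\lambda_{\min}$ for the smallest eigenvalue of a symmetric matrix. The thresholded least-squares estimator (T-LSE) is $\hat A_n=\Pi_K(\bar A)$, where $\bar A=Y^\top X(X^\top X)^{-1}$ is the least-squares estimator (with the convention $\bar A=\hat A_n=0$ if $X^\top X$ is singular), $\Pi_K$ denotes the rank-$K$ truncated singular value decomposition, and $K$ is the number of indices $i\le\min(d_x,d_y)$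 with $$ s_i(\bar A)\ \ge\ \xi:=\frac{2\sigma\left(\sqrt{d_x}+\sqrt{d_y}+\sqrt{\log(1/\delta)}\right)}{\sqrt{n\,\lambda_{\min}(\hat\Sigma)}} .$$ If $n\ge c\,(d_x+\log(1/\delta))$, then with probability at least $1-\delta$, $$\|\hat A_n-A\|_{\mathrm F}^2\ \le\ C\min_{0\le k\le r}\left[\frac{k\sigma^2\left(d_x+d_y+\log(1/\delta)\right)}{n\,\lambda_{\min}(\Sigma)}+\sum_{i=k+1}^{\min(d_x,d_y)} s_i(A)^2\right].$$ -/

import Mathlib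

open MeasureTheory ProbabilityTheory Matrix
open scoped Matrix.Norms.Frobenius

namespace TLSE

noncomputable section

/-- The singular values of a real matrix, in decreasing order and indexed from `0`
(so `sval M i` is the `(i+1)`-th largest singular value). -/
def sval {m d : ℕ} (M : Matrix (Fin m) (Fin d) ℝ) (i : ℕ) : ℝ :=
  (Matrix.toEuclideanLin M).singularValues i

/-- Right singular vectors of `M`: an orthonormal eigenbasis of `Mᵀ M`, ordered by decreasing
singular value. -/
def rightSingularBasis {m d : ℕ} (M : Matrix (Fin m) (Fin d) ℝ) :
    OrthonormalBasis (Fin d) ℝ (EuclideanSpace ℝ (Fin d)) :=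
  (Matrix.toEuclideanLin M).isSymmetric_adjoint_comp_self.eigenvectorBasis
    finrank_euclideanSpace_fin

/-- The rank-`k` truncated singular value decomposition `Π_k(M) = ∑_{i ≤ k} s_i u_i v_iᵀ`,
where `s_i u_i = M v_i`. -/
def truncSVD {m d : ℕ} (M : Matrix (Fin m) (Fin d) ℝ) (k : ℕ) : Matrix (Fin m) (Fin d) ℝ :=
  ∑ i : Fin d with i.val < k,
    Matrix.vecMulVec (M *ᵥ (rightSingularBasis M i).ofLp) (rightSingularBasis M i).ofLp

/-- The number of singular values of `M` (among the first `min m d`) that are at least `ξ`; as they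
are in decreasing order, this is the largest (one-based) index `i` with `s_i(M) ≥ ξ`, and `0` if
there is none. -/
def thresholdRank {m d : ℕ} (M : Matrix (Fin m) (Fin d) ℝ) (ξ : ℝ) : ℕ :=
  Set.ncard {i : ℕ | i < min m d ∧ ξ ≤ sval M i}

/-- Singular value hard thresholding `M(ξ)`: the singular values `≥ ξ` are kept, the others are
set to zero. -/
def svThreshold {m d : ℕ} (M : Matrix (Fin m) (Fin d) ℝ) (ξ : ℝ) : Matrix (Fin m) (Fin d) ℝ :=
  truncSVD M (thresholdRank M ξ)

/-- The smallest eigenvalue of a symmetric matrix. -/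
def lambdaMin {d : ℕ} (S : Matrix (Fin d) (Fin d) ℝ) : ℝ := sInf (spectrum ℝ S)

/-- The `n × d` matrix whose rows are the vectors `z_1, …, z_n`. -/
def dataMatrix {n d : ℕ} (z : Fin n → EuclideanSpace ℝ (Fin d)) : Matrix (Fin n) (Fin d) ℝ :=
  Matrix.of fun i j => z i j

/-- The empirical covariance matrix `(1/n) Xᵀ X`. -/
def empCov {n d : ℕ} (X : Matrix (Fin n) (Fin d) ℝ) : Matrix (Fin d) (Fin d) ℝ :=
  (1 / (n : ℝ)) • (Xᵀ * X)

/-- The least-squares estimator `Yᵀ X (Xᵀ X)⁻¹`. If `Xᵀ X` is singular the inverse is `0` by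
convention, and so is the estimator. -/
def lse {n dx dy : ℕ} (X : Matrix (Fin n) (Fin dx) ℝ) (Y : Matrix (Fin n) (Fin dy) ℝ) :
    Matrix (Fin dy) (Fin dx) ℝ :=
  Yᵀ * X * (Xᵀ * X)⁻¹

/-- The data-dependent threshold
`2 σ (√dx + √dy + √(log (1/δ))) / √(n λ_min((1/n) Xᵀ X))`. -/
def threshold {n dx : ℕ} (σ δ : ℝ) (dy : ℕ) (X : Matrix (Fin n) (Fin dx) ℝ) : ℝ :=
  2 * σ * (√(dx : ℝ) + √(dy : ℝ) + √(Real.log (1 / δ))) / √((n : ℝ) * lambdaMin (empCov X))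

/-- The thresholded least-squares estimator T-LSE. -/
def tlse {n dx dy : ℕ} (σ δ : ℝ) (X : Matrix (Fin n) (Fin dx) ℝ)
    (Y : Matrix (Fin n) (Fin dy) ℝ) : Matrix (Fin dy) (Fin dx) ℝ :=
  svThreshold (lse X Y) (threshold σ δ dy X)

/-- The trade-off, at effective rank `k`, between the estimation error
`k σ² (dx + dy + log (1/δ)) / (n λ_min(S))` and the approximation error `∑_{i > k} s_i(A)²`
(`i > k` in one-based indexing). -/
def riskBound {dx dy : ℕ} (n : ℕ) (σ δ : ℝ) (S : Matrix (Fin dx) (Fin dx) ℝ)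
    (A : Matrix (Fin dy) (Fin dx) ℝ) (k : ℕ) : ℝ :=
  (k : ℝ) * σ ^ 2 * ((dx : ℝ) + (dy : ℝ) + Real.log (1 / δ)) / ((n : ℝ) * lambdaMin S)
    + ∑ i ∈ Finset.Ico k (min dx dy), sval A i ^ 2

end

end TLSE

/-! The proof separates a deterministic oracle inequality from two Gaussian estimates.

Deterministic part (`norm_svThreshold_sub_sq_le`): suppose `M - A` has operator norm at most `19/20
* ξ`. By Weyl's inequality every kept index has `s_i(A) ≥ ξ/20`, so the number `K` of kept values
satisfies `K ξ² ≤ k ξ² + 400 ∑_{i>k} s_i(A)²` for every `k`. The discarded values of `A` are at most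
`2ξ`, and the two rank-`K` truncations differ by a matrix of rank at most `2K` and operator norm at
most `4ξ`.

Random part: the error of least squares is `Nᵀ X (Xᵀ X)⁻¹`. With `X` frozen and its columns
orthonormalised, the noise becomes a Gaussian matrix whose norm is controlled by a net
(`noise_real_not_le`); independence lets `X` be random again. A second net argument
(`design_real_not_le_norm_le`) bounds `X` below, so that `λ_min` of the empirical covariance is at
least `λ_min(Σ)/25`. Each bad event costs `δ/2`.

The factor `2` in `ξ` is prescribed, so the noise bound needs a constant below `2`. This is why the
net argument loses only `8/7` and the net is taken in the smaller dimension. -/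

namespace TLSE

open scoped RealInnerProductSpace

/-! ### Singular values, truncation and Weyl's inequality -/

section SingularValues

variable {m d : ℕ}

lemma frobenius_sq_eq_sum (B : Matrix (Fin m) (Fin d) ℝ) {ι : Type*} [Fintype ι]
    (b : OrthonormalBasis ι ℝ (EuclideanSpace ℝ (Fin d))) :
    ‖B‖ ^ 2 = ∑ i, ‖Matrix.toEuclideanLin B (b i)‖ ^ 2 := by
  have h1 : ∀ i, ‖Matrix.toEuclideanLin B (b i)‖ ^ 2
      = ∑ j, ⟪b i, (WithLp.toLp 2 (B j) : EuclideanSpace ℝ (Fin d))⟫ ^ 2 := by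
    intro i
    rw [EuclideanSpace.real_norm_sq_eq]
    refine Finset.sum_congr rfl fun j _ => ?_
    simp [Matrix.toLpLin_apply, Matrix.mulVec, dotProduct, PiLp.inner_apply]
  simp_rw [h1]
  rw [Finset.sum_comm]
  simp_rw [b.sum_sq_inner_right, EuclideanSpace.real_norm_sq_eq]
  rw [Matrix.frobenius_norm_def, ← Real.sqrt_eq_rpow, Real.sq_sqrt (by positivity)]
  simp

lemma sval_nonneg (M : Matrix (Fin m) (Fin d) ℝ) (i : ℕ) : 0 ≤ sval M i :=
  LinearMap.singularValues_nonneg _ _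

lemma sval_antitone (M : Matrix (Fin m) (Fin d) ℝ) : Antitone (sval M) :=
  LinearMap.singularValues_antitone _

lemma sval_eq_zero_of_finrank_le (M : Matrix (Fin m) (Fin d) ℝ) {i : ℕ}
    (hi : Module.finrank ℝ (Matrix.toEuclideanLin M).range ≤ i) : sval M i = 0 :=
  (LinearMap.singularValues_eq_zero_iff_le_finrank_range _).2 hi

lemma sval_eq_zero_of_min_le (M : Matrix (Fin m) (Fin d) ℝ) {i : ℕ}
    (hi : min m d ≤ i) : sval M i = 0 := by
  apply sval_eq_zero_of_finrank_le
  refine le_trans (le_min ?_ ?_) hi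
  · simpa using Submodule.finrank_le (Matrix.toEuclideanLin M).range
  · simpa using LinearMap.finrank_range_le (Matrix.toEuclideanLin M)

lemma norm_sq_apply_eq_sum_singularValues {E F : Type*} [NormedAddCommGroup E]
    [InnerProductSpace ℝ E] [FiniteDimensional ℝ E] [NormedAddCommGroup F] [InnerProductSpace ℝ F]
    [FiniteDimensional ℝ F] (T : E →ₗ[ℝ] F) {n : ℕ} (hn : Module.finrank ℝ E = n) (v : E) :
    ‖T v‖ ^ 2 = ∑ i : Fin n, T.singularValues i ^ 2 *
      ⟪T.isSymmetric_adjoint_comp_self.eigenvectorBasis hn i, v⟫ ^ 2 := by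
  have h := T.isSymmetric_adjoint_comp_self.eigenvectorBasis_apply_self_apply hn v
  simp only [OrthonormalBasis.repr_apply_apply] at h
  rw [← real_inner_self_eq_norm_sq, ← LinearMap.adjoint_inner_left,
    ← (T.isSymmetric_adjoint_comp_self.eigenvectorBasis hn).sum_inner_mul_inner]
  refine Finset.sum_congr rfl fun i _ => ?_
  rw [LinearMap.sq_singularValues_fin _ hn i, real_inner_comm, ← LinearMap.comp_apply, h i]
  simp only [RCLike.ofReal_real_eq_id, id]
  ring

lemma norm_sq_toEuclideanLin (M : Matrix (Fin m) (Fin d) ℝ) (v : EuclideanSpace ℝ (Fin d)) :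
    ‖Matrix.toEuclideanLin M v‖ ^ 2
      = ∑ i : Fin d, sval M i ^ 2 * ⟪rightSingularBasis M i, v⟫ ^ 2 := by
  have h := norm_sq_apply_eq_sum_singularValues (Matrix.toEuclideanLin M)
    finrank_euclideanSpace_fin v
  exact h

/-- Truncating amounts to projecting onto the first `k` right singular vectors before applying `M`,
so left singular vectors are never needed. -/
lemma toEuclideanLin_truncSVD (M : Matrix (Fin m) (Fin d) ℝ) (k : ℕ)
    (v : EuclideanSpace ℝ (Fin d)) :
    Matrix.toEuclideanLin (truncSVD M k) v = Matrix.toEuclideanLin M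
      (∑ i : Fin d with i.val < k, ⟪rightSingularBasis M i, v⟫ • rightSingularBasis M i) := by
  rw [truncSVD, map_sum, map_sum, LinearMap.sum_apply]
  refine Finset.sum_congr rfl fun i _ => ?_
  ext j
  simp [Matrix.toLpLin_apply, Matrix.vecMulVec_mulVec, PiLp.inner_apply, dotProduct, mul_comm]

lemma norm_sq_toEuclideanLin_sub_truncSVD (M : Matrix (Fin m) (Fin d) ℝ) (k : ℕ)
    (v : EuclideanSpace ℝ (Fin d)) :
    ‖Matrix.toEuclideanLin (M - truncSVD M k) v‖ ^ 2
      = ∑ i : Fin d with ¬ i.val < k, sval M i ^ 2 * ⟪rightSingularBasis M i, v⟫ ^ 2 := by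
  rw [map_sub, LinearMap.sub_apply, toEuclideanLin_truncSVD, ← map_sub, norm_sq_toEuclideanLin]
  conv_rhs => rw [Finset.sum_filter]
  refine Finset.sum_congr rfl fun i _ => ?_
  rw [inner_sub_right, inner_sum]
  have h := (rightSingularBasis M).inner_eq_ite
  simp only [inner_smul_right, h]
  split_ifs with hi <;> simp [hi]

lemma sum_fin_filter_not_lt {β : Type*} [AddCommMonoid β] (f : ℕ → β) (k : ℕ) :
    ∑ i : Fin d with ¬ i.val < k, f i = ∑ i ∈ Finset.Ico k d, f i := by
  rw [Finset.sum_filter, Fin.sum_univ_eq_sum_range (fun i => if ¬ i < k then f i else 0),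
    ← Finset.sum_filter]
  congr 1
  ext i
  simp
  omega

lemma frobenius_sq_sub_truncSVD (M : Matrix (Fin m) (Fin d) ℝ) (k : ℕ) :
    ‖M - truncSVD M k‖ ^ 2 = ∑ i ∈ Finset.Ico k d, sval M i ^ 2 := by
  rw [frobenius_sq_eq_sum _ (rightSingularBasis M)]
  simp_rw [norm_sq_toEuclideanLin_sub_truncSVD, (rightSingularBasis M).inner_eq_ite]
  rw [← sum_fin_filter_not_lt, Finset.sum_comm' (t' := {i : Fin d | ¬ i.val < k})
    (s' := fun _ => Finset.univ) (by simp)]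
  simp

lemma frobenius_sq_eq_sum_sval (M : Matrix (Fin m) (Fin d) ℝ) :
    ‖M‖ ^ 2 = ∑ i ∈ Finset.range d, sval M i ^ 2 := by
  rw [Finset.range_eq_Ico, ← frobenius_sq_sub_truncSVD M 0]
  simp [truncSVD]

lemma norm_toEuclideanLin_sub_truncSVD_le (M : Matrix (Fin m) (Fin d) ℝ) (k : ℕ)
    (v : EuclideanSpace ℝ (Fin d)) :
    ‖Matrix.toEuclideanLin (M - truncSVD M k) v‖ ≤ sval M k * ‖v‖ := by
  refine le_of_sq_le_sq ?_ (mul_nonneg (sval_nonneg _ _) (norm_nonneg _))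
  rw [norm_sq_toEuclideanLin_sub_truncSVD, mul_pow, ← (rightSingularBasis M).sum_sq_inner_right,
    Finset.mul_sum]
  rw [Finset.sum_filter]
  refine Finset.sum_le_sum fun i _ => ?_
  split_ifs with hi
  · positivity
  · have h1 := sval_antitone M (not_lt.1 hi)
    have h2 := sval_nonneg M i
    gcongr

lemma norm_toEuclideanLin_rightSingularBasis (M : Matrix (Fin m) (Fin d) ℝ) (i : Fin d) :
    ‖Matrix.toEuclideanLin M (rightSingularBasis M i)‖ = sval M i := by
  rw [← sq_eq_sq₀ (norm_nonneg _) (sval_nonneg _ _), norm_sq_toEuclideanLin]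
  simp [(rightSingularBasis M).inner_eq_ite]

lemma sval_zero_le (M : Matrix (Fin m) (Fin d) ℝ) {b : ℝ} (hb : 0 ≤ b)
    (h : ∀ v, ‖Matrix.toEuclideanLin M v‖ ≤ b * ‖v‖) : sval M 0 ≤ b := by
  rcases Nat.eq_zero_or_pos d with hd | hd
  · rw [sval_eq_zero_of_min_le M (by omega)]; exact hb
  · have := h (rightSingularBasis M ⟨0, hd⟩)
    rw [norm_toEuclideanLin_rightSingularBasis] at this
    simpa using this

/-- A subspace of dimension `> k` contains a vector stretched by at most `s_{k+1}`. -/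
lemma exists_norm_le_sval (M : Matrix (Fin m) (Fin d) ℝ) (k : ℕ)
    (V : Submodule ℝ (EuclideanSpace ℝ (Fin d))) (hV : k < Module.finrank ℝ V) :
    ∃ v ∈ V, v ≠ 0 ∧ ‖Matrix.toEuclideanLin M v‖ ≤ sval M k * ‖v‖ := by
  -- The kernel of `φ` is the part of `V` orthogonal to the first `k` right singular vectors, where
  -- `M` agrees with `M - truncSVD M k`. Since `k < dim V ≤ d`, the `else` branch never occurs.
  let φ : V →ₗ[ℝ] (Fin k → ℝ) := LinearMap.pi fun i =>
    if h : i.val < d then (innerₗ _ (rightSingularBasis M ⟨i, h⟩)) ∘ₗ V.subtype else 0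
  have hφ : LinearMap.ker φ ≠ ⊥ := by
    apply LinearMap.ker_ne_bot_of_finrank_lt
    simpa using hV
  obtain ⟨v, hv, hv0⟩ := Submodule.exists_mem_ne_zero_of_ne_bot hφ
  refine ⟨v, v.2, by simpa using hv0, ?_⟩
  have hz : ∀ i : Fin d, i.val < k →
      ⟪rightSingularBasis M i, (v : EuclideanSpace ℝ (Fin d))⟫ = 0 := by
    intro i hi
    have := congrFun (LinearMap.mem_ker.1 hv) ⟨i, hi⟩
    simpa [φ] using this
  have h0 : Matrix.toEuclideanLin (truncSVD M k) (v : EuclideanSpace ℝ (Fin d)) = 0 := by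
    rw [toEuclideanLin_truncSVD, Finset.sum_eq_zero, map_zero]
    intro i hi
    rw [hz i (by simpa using hi), zero_smul]
  have h1 := norm_toEuclideanLin_sub_truncSVD_le M k (v : EuclideanSpace ℝ (Fin d))
  rwa [map_sub, LinearMap.sub_apply, h0, sub_zero] at h1

/-- Weyl's inequality for singular values. -/
lemma sval_le_sval_add (M A : Matrix (Fin m) (Fin d) ℝ) {b : ℝ} (hb : 0 ≤ b)
    (h : ∀ v, ‖Matrix.toEuclideanLin (M - A) v‖ ≤ b * ‖v‖) (k : ℕ) :
    sval M k ≤ sval A k + b := by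
  rcases le_or_gt d k with hd | hd
  · rw [sval_eq_zero_of_min_le M (by omega)]
    have := sval_nonneg A k
    positivity
  -- On the span of the first `k + 1` right singular vectors `M` stretches by at least `sval M k`;
  -- by dimension, some vector there is stretched by `A` by at most `sval A k`.
  let e : Fin (k + 1) → Fin d := Fin.castLE hd
  let V := Submodule.span ℝ (Set.range (rightSingularBasis M ∘ e))
  have hli : LinearIndependent ℝ (rightSingularBasis M ∘ e) :=
    (rightSingularBasis M).orthonormal.linearIndependent.comp _ (Fin.castLE_injective hd)
  have hV : k < Module.finrank ℝ V := by
    rw [finrank_span_eq_card hli]; simp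
  obtain ⟨v, hv, hv0, hAv⟩ := exists_norm_le_sval A k V hV
  have hperp : ∀ i : Fin d, k < i.val → ⟪rightSingularBasis M i, v⟫ = 0 := by
    intro i hi
    have : V ≤ LinearMap.ker (innerₗ _ (rightSingularBasis M i)) := by
      rw [Submodule.span_le]
      rintro _ ⟨j, rfl⟩
      have hij : i ≠ e j := by
        intro h
        have := congrArg Fin.val h
        simp [e] at this
        omega
      simp [(rightSingularBasis M).inner_eq_ite, hij]
    simpa using this hv
  have hMv : sval M k * ‖v‖ ≤ ‖Matrix.toEuclideanLin M v‖ := by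
    refine le_of_sq_le_sq ?_ (norm_nonneg _)
    rw [norm_sq_toEuclideanLin, mul_pow, ← (rightSingularBasis M).sum_sq_inner_right,
      Finset.mul_sum]
    refine Finset.sum_le_sum fun i _ => ?_
    rcases lt_or_ge k i.val with hi | hi
    · simp [hperp i hi]
    · have h1 := sval_antitone M hi
      have h2 := sval_nonneg M k
      gcongr
  have hE := h v
  rw [map_sub, LinearMap.sub_apply] at hE
  have h3 : ‖Matrix.toEuclideanLin M v‖ ≤ ‖Matrix.toEuclideanLin A v‖ +
      ‖Matrix.toEuclideanLin M v - Matrix.toEuclideanLin A v‖ := by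
    simpa using norm_add_le (Matrix.toEuclideanLin A v)
      (Matrix.toEuclideanLin M v - Matrix.toEuclideanLin A v)
  refine le_of_mul_le_mul_right ?_ (norm_pos_iff.2 hv0)
  linarith [add_mul (sval A k) b ‖v‖]

/-- At most `k` singular values are nonzero, and each is at most the operator norm. -/
lemma frobenius_sq_le_finrank_mul (B : Matrix (Fin m) (Fin d) ℝ) {b : ℝ} (hb : 0 ≤ b)
    (h : ∀ v, ‖Matrix.toEuclideanLin B v‖ ≤ b * ‖v‖) {k : ℕ}
    (hk : Module.finrank ℝ (Matrix.toEuclideanLin B).range ≤ k) :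
    ‖B‖ ^ 2 ≤ k * b ^ 2 := by
  rw [frobenius_sq_eq_sum_sval]
  calc ∑ i ∈ Finset.range d, sval B i ^ 2
      ≤ ∑ i ∈ Finset.range d, (if i < k then b ^ 2 else 0) := by
        refine Finset.sum_le_sum fun i _ => ?_
        split_ifs with hi
        · have := (sval_antitone B (Nat.zero_le i)).trans (sval_zero_le B hb h)
          have := sval_nonneg B i
          gcongr
        · rw [sval_eq_zero_of_finrank_le B (by omega)]; simp
    _ ≤ k * b ^ 2 := by
        rw [← Finset.sum_filter, Finset.sum_const, nsmul_eq_mul]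
        gcongr
        refine (Finset.card_le_card (t := Finset.range k) ?_).trans (by simp)
        intro i; simp

lemma finrank_range_truncSVD_le (M : Matrix (Fin m) (Fin d) ℝ) (k : ℕ) :
    Module.finrank ℝ (Matrix.toEuclideanLin (truncSVD M k)).range ≤ k := by
  let s : Finset (Fin d) := {i : Fin d | i.val < k}
  let V := Submodule.span ℝ
    ((s.image fun i => Matrix.toEuclideanLin M (rightSingularBasis M i) :
      Finset (EuclideanSpace ℝ (Fin m))) : Set (EuclideanSpace ℝ (Fin m)))
  have hle : (Matrix.toEuclideanLin (truncSVD M k)).range ≤ V := by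
    rintro _ ⟨v, rfl⟩
    rw [toEuclideanLin_truncSVD, map_sum]
    refine Submodule.sum_mem _ fun i hi => ?_
    rw [map_smul]
    exact Submodule.smul_mem _ _ (Submodule.subset_span (by
      simp only [Finset.coe_image]
      exact ⟨i, hi, rfl⟩))
  refine (Submodule.finrank_mono hle).trans ((finrank_span_finset_le_card _).trans
    (Finset.card_image_le.trans ?_))
  have : s.card = (s.map Fin.valEmbedding).card := by simp
  rw [this]
  refine (Finset.card_le_card (t := Finset.range k) ?_).trans (by simp)
  intro i
  simp [s]
  rintro a ha rfl
  exact ha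

end SingularValues

/-! ### Oracle inequality for hard thresholding -/

section Threshold

variable {m d : ℕ}

/-- Monotonicity makes the set of kept indices an initial segment, so its cardinality is also the
cut-off index. -/
lemma setOf_le_sval_eq_Iio (M : Matrix (Fin m) (Fin d) ℝ) (ξ : ℝ) :
    {i : ℕ | i < min m d ∧ ξ ≤ sval M i} = Set.Iio (thresholdRank M ξ) := by
  have hlow : IsLowerSet {i : ℕ | i < min m d ∧ ξ ≤ sval M i} := fun a b hba ha =>
    ⟨lt_of_le_of_lt hba ha.1, ha.2.trans (sval_antitone M hba)⟩
  have hfin : {i : ℕ | i < min m d ∧ ξ ≤ sval M i}.Finite :=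
    (Set.finite_Iio (min m d)).subset fun i hi => hi.1
  obtain ⟨n, hn⟩ := hlow.eq_univ_or_Iio.resolve_left
    (fun h => Set.infinite_univ (h ▸ hfin))
  rw [thresholdRank, hn]
  simp [Set.ncard_eq_toFinset_card']

lemma le_sval_of_lt_thresholdRank (M : Matrix (Fin m) (Fin d) ℝ) (ξ : ℝ) {i : ℕ}
    (hi : i < thresholdRank M ξ) : ξ ≤ sval M i := by
  have : i ∈ Set.Iio (thresholdRank M ξ) := hi
  rw [← setOf_le_sval_eq_Iio] at this
  exact this.2

lemma thresholdRank_le_min (M : Matrix (Fin m) (Fin d) ℝ) (ξ : ℝ) :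
    thresholdRank M ξ ≤ min m d := by
  by_contra! h
  have : min m d ∈ Set.Iio (thresholdRank M ξ) := h
  rw [← setOf_le_sval_eq_Iio] at this
  exact absurd this.1 (lt_irrefl _)

lemma sval_thresholdRank_le (M : Matrix (Fin m) (Fin d) ℝ) {ξ : ℝ} (hξ : 0 ≤ ξ) :
    sval M (thresholdRank M ξ) ≤ ξ := by
  by_contra! h
  rcases lt_or_ge (thresholdRank M ξ) (min m d) with h1 | h1
  · have : thresholdRank M ξ ∈ {i : ℕ | i < min m d ∧ ξ ≤ sval M i} := ⟨h1, h.le⟩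
    rw [setOf_le_sval_eq_Iio] at this
    exact lt_irrefl _ (Set.mem_Iio.1 this)
  · rw [sval_eq_zero_of_min_le M h1] at h
    linarith

/-- Indices below `k` are charged `a` each, the others to the tail of `g`. As `k` is unrelated to
`s`, the data-driven rank can be compared with any oracle rank. -/
lemma sum_le_mul_add_sum_Ico {s : Finset ℕ} {N : ℕ} (hs : s ⊆ Finset.range N) {f g : ℕ → ℝ}
    {a : ℝ} (ha : 0 ≤ a) (hf : ∀ i ∈ s, f i ≤ a) (hfg : ∀ i ∈ s, f i ≤ g i) (hg : ∀ i, 0 ≤ g i)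
    (k : ℕ) : ∑ i ∈ s, f i ≤ k * a + ∑ i ∈ Finset.Ico k N, g i := by
  rw [← Finset.sum_filter_add_sum_filter_not s (· < k)]
  refine add_le_add ?_ ?_
  · refine (Finset.sum_le_card_nsmul _ _ a fun i hi => hf i (Finset.mem_filter.1 hi).1).trans ?_
    rw [nsmul_eq_mul]
    gcongr
    refine (Finset.card_le_card (t := Finset.range k) ?_).trans (by simp)
    intro i hi
    simpa using (Finset.mem_filter.1 hi).2
  · refine (Finset.sum_le_sum fun i hi => hfg i (Finset.mem_filter.1 hi).1).trans ?_
    refine Finset.sum_le_sum_of_subset_of_nonneg ?_ fun i _ _ => hg i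
    intro i hi
    have h1 := hs (Finset.mem_filter.1 hi).1
    have h2 := (Finset.mem_filter.1 hi).2
    simp at h1 h2 ⊢
    omega

/-- Oracle inequality for singular value thresholding: a perturbation of operator norm at most
`19/20` of the threshold costs `ξ²` per singular value that is kept. -/
theorem norm_svThreshold_sub_sq_le (M A : Matrix (Fin m) (Fin d) ℝ) {b ξ : ℝ} (hb : 0 ≤ b)
    (hξ : 0 ≤ ξ) (hbξ : b ≤ 19 / 20 * ξ)
    (h : ∀ v, ‖Matrix.toEuclideanLin (M - A) v‖ ≤ b * ‖v‖) (k : ℕ) :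
    ‖svThreshold M ξ - A‖ ^ 2 ≤
      30000 * (k * ξ ^ 2 + ∑ i ∈ Finset.Ico k (min d m), sval A i ^ 2) := by
  rw [min_comm]
  set K := thresholdRank M ξ with hK
  set R := ∑ i ∈ Finset.Ico k (min m d), sval A i ^ 2 with hR
  have hR0 : 0 ≤ R := Finset.sum_nonneg fun i _ => sq_nonneg _
  have hKN : K ≤ min m d := thresholdRank_le_min M ξ
  have hsymm : ∀ v, ‖Matrix.toEuclideanLin (A - M) v‖ ≤ b * ‖v‖ := by
    intro v
    rw [← neg_sub, map_neg, LinearMap.neg_apply, norm_neg]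
    exact h v
  have hsK : sval M K ≤ ξ := sval_thresholdRank_le M hξ
  have hsKA : sval A K ≤ 2 * ξ := by
    linarith [sval_le_sval_add A M hb hsymm K]
  have hcount : K * ξ ^ 2 ≤ k * ξ ^ 2 + 400 * R := by
    have h1 := sum_le_mul_add_sum_Ico (s := Finset.range K) (N := min m d)
      (Finset.range_mono hKN) (f := fun _ => ξ ^ 2) (g := fun i => 400 * sval A i ^ 2)
      (a := ξ ^ 2) (sq_nonneg _) (fun _ _ => le_rfl) ?_ (fun i => by positivity) k
    · simpa [← Finset.mul_sum] using h1
    · intro i hi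
      have h1 := le_sval_of_lt_thresholdRank M ξ (Finset.mem_range.1 hi)
      have h2 := sval_le_sval_add M A hb h i
      -- The margin `ξ - b ≥ ξ/20` is used here; its inverse square is the factor `400`.
      have h3 : ξ ≤ 20 * sval A i := by linarith
      calc ξ ^ 2 ≤ (20 * sval A i) ^ 2 := by gcongr
        _ = 400 * sval A i ^ 2 := by ring
  have htail : ‖A - truncSVD A K‖ ^ 2 ≤ 4 * (k * ξ ^ 2) + R := by
    have h0 : ∑ i ∈ Finset.Ico K d, sval A i ^ 2 = ∑ i ∈ Finset.Ico K (min m d), sval A i ^ 2 := by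
      symm
      refine Finset.sum_subset (Finset.Ico_subset_Ico_right (min_le_right _ _)) fun i hi hi' => ?_
      rw [sval_eq_zero_of_min_le A (by simp at hi hi'; omega)]
      simp
    rw [frobenius_sq_sub_truncSVD, h0]
    have h1 := sum_le_mul_add_sum_Ico (s := Finset.Ico K (min m d)) (N := min m d)
      (by intro i; simp) (f := fun i => sval A i ^ 2) (g := fun i => sval A i ^ 2)
      (a := 4 * ξ ^ 2) (by positivity) ?_ (fun _ _ => le_rfl) (fun i => by positivity) k
    · linarith
    · intro i hi
      have h2 := sval_antitone A (Finset.mem_Ico.1 hi).1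
      have h3 := sval_nonneg A i
      calc sval A i ^ 2 ≤ (2 * ξ) ^ 2 := by gcongr; linarith
        _ = 4 * ξ ^ 2 := by ring
  have hhead : ‖truncSVD M K - truncSVD A K‖ ^ 2 ≤ (2 * K : ℕ) * (4 * ξ) ^ 2 := by
    apply frobenius_sq_le_finrank_mul _ (by positivity)
    · intro v
      have e : truncSVD M K - truncSVD A K
          = (A - truncSVD A K) - (M - truncSVD M K) + (M - A) := by abel
      rw [e, map_add, map_sub, LinearMap.add_apply, LinearMap.sub_apply]
      have h1 := norm_toEuclideanLin_sub_truncSVD_le M K v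
      have h2 := norm_toEuclideanLin_sub_truncSVD_le A K v
      have h3 := h v
      have h4 := mul_le_mul_of_nonneg_right hsK (norm_nonneg v)
      have h5 := mul_le_mul_of_nonneg_right hsKA (norm_nonneg v)
      have h6 := mul_le_mul_of_nonneg_right (show b ≤ ξ by linarith) (norm_nonneg v)
      refine (norm_add_le _ _).trans ((add_le_add_left (norm_sub_le _ _) _).trans ?_)
      linarith
    · rw [map_sub]
      have hle : (Matrix.toEuclideanLin (truncSVD M K) - Matrix.toEuclideanLin (truncSVD A K)).range
          ≤ (Matrix.toEuclideanLin (truncSVD M K)).range ⊔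
            (Matrix.toEuclideanLin (truncSVD A K)).range := by
        rintro _ ⟨v, rfl⟩
        rw [LinearMap.sub_apply]
        exact Submodule.sub_mem _ (Submodule.mem_sup_left ⟨v, rfl⟩)
          (Submodule.mem_sup_right ⟨v, rfl⟩)
      refine (Submodule.finrank_mono hle).trans
        ((Submodule.finrank_add_le_finrank_add_finrank _ _).trans ?_)
      have h1 := finrank_range_truncSVD_le M K
      have h2 := finrank_range_truncSVD_le A K
      omega
  have htri : ‖svThreshold M ξ - A‖ ≤ ‖truncSVD M K - truncSVD A K‖ + ‖A - truncSVD A K‖ := by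
    have e : svThreshold M ξ - A = (truncSVD M K - truncSVD A K) - (A - truncSVD A K) := by
      rw [svThreshold]; abel
    rw [e]
    exact norm_sub_le _ _
  have hk0 : 0 ≤ k * ξ ^ 2 := by positivity
  push_cast at hhead
  calc ‖svThreshold M ξ - A‖ ^ 2
      ≤ (‖truncSVD M K - truncSVD A K‖ + ‖A - truncSVD A K‖) ^ 2 := by gcongr
    _ ≤ 2 * ‖truncSVD M K - truncSVD A K‖ ^ 2 + 2 * ‖A - truncSVD A K‖ ^ 2 := by
        linarith [sq_nonneg (‖truncSVD M K - truncSVD A K‖ - ‖A - truncSVD A K‖)]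
    _ ≤ _ := by linarith

end Threshold

/-! ### Tails of the norm of a standard Gaussian vector -/

section ChiSquare

lemma integrable_exp_mul_sq_gaussianReal {u : ℝ} (hu : 0 < u) :
    Integrable (fun x : ℝ => Real.exp ((1 - u⁻¹) / 2 * x ^ 2)) (gaussianReal 0 1) := by
  rw [gaussianReal_of_var_ne_zero _ one_ne_zero]
  rw [integrable_withDensity_iff_integrable_smul₀' (by fun_prop)
    (by filter_upwards with x using gaussianPDF_lt_top)]
  have h := (integrable_exp_neg_mul_sq (b := (2 * u)⁻¹) (by positivity)).const_mul
    ((√(2 * Real.pi))⁻¹)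
  refine h.congr ?_
  filter_upwards with x
  simp only [toReal_gaussianPDF, gaussianPDFReal, smul_eq_mul, NNReal.coe_one, mul_one, sub_zero]
  rw [mul_assoc, ← Real.exp_add]
  congr 2
  field_simp
  ring

/-- The tilt turns the standard density into that of variance `u`, up to the factor `√u`. It is the
optimal Chernoff parameter for the level `m * u`. -/
lemma integral_exp_mul_sq_gaussianReal {u : ℝ} (hu : 0 < u) :
    ∫ x : ℝ, Real.exp ((1 - u⁻¹) / 2 * x ^ 2) ∂(gaussianReal 0 1) = √u := by
  rw [integral_gaussianReal_eq_integral_smul one_ne_zero]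
  have h : ∀ x : ℝ, gaussianPDFReal 0 1 x • Real.exp ((1 - u⁻¹) / 2 * x ^ 2)
      = (√(2 * Real.pi))⁻¹ * Real.exp (-(2 * u)⁻¹ * x ^ 2) := by
    intro x
    simp only [gaussianPDFReal, smul_eq_mul, NNReal.coe_one, mul_one, sub_zero]
    rw [mul_assoc, ← Real.exp_add]
    congr 2
    field_simp
    ring
  simp_rw [h]
  rw [integral_const_mul, integral_gaussian, ← Real.sqrt_inv, ← Real.sqrt_mul (by positivity)]
  congr 1
  field_simp

variable {m : ℕ}

lemma exp_mul_norm_sq_eq_prod (c : ℝ) (x : Fin m → ℝ) :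
    Real.exp (c * ‖(WithLp.toLp 2 x : EuclideanSpace ℝ (Fin m))‖ ^ 2)
      = ∏ i, Real.exp (c * x i ^ 2) := by
  rw [EuclideanSpace.real_norm_sq_eq, Finset.mul_sum, Real.exp_sum]

lemma integrable_exp_mul_norm_sq_stdGaussian {u : ℝ} (hu : 0 < u) :
    Integrable (fun x => Real.exp ((1 - u⁻¹) / 2 * ‖x‖ ^ 2))
      (stdGaussian (EuclideanSpace ℝ (Fin m))) := by
  rw [← map_pi_eq_stdGaussian, integrable_map_measure (by fun_prop) (by fun_prop)]
  simp_rw [Function.comp_def, exp_mul_norm_sq_eq_prod]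
  exact Integrable.fintype_prod fun _ => integrable_exp_mul_sq_gaussianReal hu

lemma integral_exp_mul_norm_sq_stdGaussian {u : ℝ} (hu : 0 < u) :
    ∫ x, Real.exp ((1 - u⁻¹) / 2 * ‖x‖ ^ 2) ∂(stdGaussian (EuclideanSpace ℝ (Fin m)))
      = √u ^ m := by
  rw [← map_pi_eq_stdGaussian, integral_map (by fun_prop) (by fun_prop)]
  simp_rw [exp_mul_norm_sq_eq_prod]
  rw [integral_fintype_prod_eq_prod
    (f := fun (_ : Fin m) (x : ℝ) => Real.exp ((1 - u⁻¹) / 2 * x ^ 2))]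
  simp [integral_exp_mul_sq_gaussianReal hu]

/-- Chernoff bound for the squared norm of a standard Gaussian vector: an upper tail bound if
`1 ≤ u` and a lower tail bound if `u ≤ 1`. -/
lemma stdGaussian_real_tail_le {u : ℝ} (hu : 0 < u) :
    (stdGaussian (EuclideanSpace ℝ (Fin m))).real
        {x | (1 - u⁻¹) / 2 * (m * u) ≤ (1 - u⁻¹) / 2 * ‖x‖ ^ 2}
      ≤ Real.exp (-(m / 2 * (u - 1 - Real.log u))) := by
  refine (measure_ge_le_exp_mul_mgf (X := fun x => (1 - u⁻¹) / 2 * ‖x‖ ^ 2) _ zero_le_one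
    (by simpa using integrable_exp_mul_norm_sq_stdGaussian hu)).trans (le_of_eq ?_)
  have h : √u ^ m = Real.exp (m / 2 * Real.log u) := by
    rw [← Real.exp_log (Real.sqrt_pos.2 hu), ← Real.exp_nat_mul, Real.log_sqrt hu.le]
    congr 1; ring
  simp only [mgf, one_mul]
  rw [integral_exp_mul_norm_sq_stdGaussian hu, h, ← Real.exp_add]
  congr 1
  field_simp
  ring

lemma stdGaussian_real_norm_ge_le (hm : 0 < m) {t : ℝ} (ht : 0 ≤ t) :
    (stdGaussian (EuclideanSpace ℝ (Fin m))).real {x | √m + t ≤ ‖x‖}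
      ≤ Real.exp (-(t ^ 2 / 2)) := by
  have hm' : 0 < √(m : ℝ) := Real.sqrt_pos.2 (by exact_mod_cast hm)
  have hmm : √(m : ℝ) ^ 2 = m := Real.sq_sqrt (by positivity)
  set s := t / √m with hs
  have hs0 : 0 ≤ s := by positivity
  have hts : t = √m * s := by rw [hs]; field_simp
  -- With `u = (1 + s)²` the level `m * u` is `(√m + t)²`, and `log (1 + s) ≤ s` reduces the
  -- exponent to `t²/2`.
  have hu : 0 < (1 + s) ^ 2 := by positivity
  have hc : 0 ≤ (1 - ((1 + s) ^ 2)⁻¹) / 2 := by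
    have : ((1 + s) ^ 2)⁻¹ ≤ 1 := inv_le_one_of_one_le₀ (by nlinarith)
    linarith
  refine (measureReal_mono ?_).trans ((stdGaussian_real_tail_le (m := m) hu).trans ?_)
  · intro x hx
    refine mul_le_mul_of_nonneg_left ?_ hc
    calc (m : ℝ) * (1 + s) ^ 2 = (√m + t) ^ 2 := by rw [hts]; linear_combination -(1 + s) ^ 2 * hmm
      _ ≤ ‖x‖ ^ 2 := by
        have : √m + t ≤ ‖x‖ := hx
        gcongr
  · apply Real.exp_le_exp.2
    rw [Real.log_pow, hts, mul_pow, hmm]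
    have := Real.log_le_sub_one_of_pos (show 0 < 1 + s by positivity)
    push_cast
    have hm0 : (0 : ℝ) ≤ m := by positivity
    nlinarith [mul_le_mul_of_nonneg_left this hm0]

lemma stdGaussian_real_norm_sq_ge_le :
    (stdGaussian (EuclideanSpace ℝ (Fin m))).real {x | m * (5 / 4) ≤ ‖x‖ ^ 2}
      ≤ Real.exp (-(m / 100)) := by
  refine (measureReal_mono ?_).trans
    ((stdGaussian_real_tail_le (m := m) (u := 5 / 4) (by norm_num)).trans ?_)
  · intro x hx
    simp only [Set.mem_ofPred_eq] at hx ⊢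
    linarith
  · apply Real.exp_le_exp.2
    have : Real.log (5 / 4) ≤ 23 / 100 := by
      rw [Real.log_le_iff_le_exp (by norm_num)]
      have := Real.quadratic_le_exp_of_nonneg (x := 23 / 100) (by norm_num)
      linarith
    have hm0 : (0 : ℝ) ≤ m := by positivity
    nlinarith [mul_le_mul_of_nonneg_left this hm0]

lemma stdGaussian_real_norm_sq_le_le :
    (stdGaussian (EuclideanSpace ℝ (Fin m))).real {x | ‖x‖ ^ 2 ≤ m * (3 / 4)}
      ≤ Real.exp (-(m / 100)) := by
  refine (measureReal_mono ?_).trans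
    ((stdGaussian_real_tail_le (m := m) (u := 3 / 4) (by norm_num)).trans ?_)
  · intro x hx
    simp only [Set.mem_ofPred_eq] at hx ⊢
    linarith
  · apply Real.exp_le_exp.2
    have : Real.log (3 / 4) ≤ -(27 / 100) := by
      have h1 : Real.exp (27 / 100) ≤ 4 / 3 := by
        have := Real.exp_bound' (x := 27 / 100) (by norm_num) (by norm_num) (n := 3) (by norm_num)
        refine this.trans ?_
        norm_num [Finset.sum_range_succ, Nat.factorial]
      have h2 : Real.log (3 / 4) = - Real.log (4 / 3) := by
        rw [← Real.log_inv]; norm_num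
      rw [h2]
      have := (Real.le_log_iff_exp_le (by norm_num : (0 : ℝ) < 4 / 3)).2 h1
      linarith
    have hm0 : (0 : ℝ) ≤ m := by positivity
    nlinarith [mul_le_mul_of_nonneg_left this hm0]

end ChiSquare

/-! ### Linear images of independent Gaussian vectors -/

section Law

variable {Ω : Type*} [MeasurableSpace Ω] {P : Measure Ω}

/-- A linear combination of independent Gaussian vectors with total covariance the identity is a
standard Gaussian vector. Here `R i` is the adjoint of `T i`. -/
lemma hasLaw_sum_stdGaussian [IsProbabilityMeasure P] {n p : ℕ}
    {F : Type*} [NormedAddCommGroup F] [InnerProductSpace ℝ F] [FiniteDimensional ℝ F]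
    [MeasurableSpace F] [BorelSpace F]
    {S : Matrix (Fin p) (Fin p) ℝ} (hS : S.PosSemidef)
    {ξ : Fin n → Ω → EuclideanSpace ℝ (Fin p)}
    (hξ : ∀ i, HasLaw (ξ i) (multivariateGaussian 0 S) P) (hind : iIndepFun ξ P)
    (T : Fin n → EuclideanSpace ℝ (Fin p) → F) (hT : ∀ i, Measurable (T i))
    (R : Fin n → F → EuclideanSpace ℝ (Fin p))
    (hTR : ∀ i x t, ⟪T i x, t⟫ = ⟪x, R i t⟫)
    (hcov : ∀ t, ∑ i, (R i t).ofLp ⬝ᵥ S *ᵥ (R i t).ofLp = ‖t‖ ^ 2) :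
    HasLaw (fun ω => ∑ i, T i (ξ i ω)) (stdGaussian F) P := by
  have hae : ∀ i, AEMeasurable (fun ω => T i (ξ i ω)) P := fun i =>
    (hT i).comp_aemeasurable (hξ i).aemeasurable
  refine ⟨Finset.aemeasurable_fun_sum _ fun i _ => hae i, ?_⟩
  have : CompleteSpace F := FiniteDimensional.complete ℝ F
  have : IsProbabilityMeasure (P.map fun ω => ∑ i, T i (ξ i ω)) :=
    Measure.isProbabilityMeasure_map (Finset.aemeasurable_fun_sum _ fun i _ => hae i)
  -- Characteristic functions multiply, and the factor of `T i` at `t` is that of the Gaussian at `R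
  -- i t`; `hcov` then sums the exponents.
  apply Measure.ext_of_charFun
  ext t
  have hind' : iIndepFun (fun i ω => T i (ξ i ω)) P := hind.comp T hT
  rw [hind'.charFun_map_fun_sum_eq_prod hae, charFun_stdGaussian, Finset.prod_apply]
  have h1 : ∀ i, charFun (P.map fun ω => T i (ξ i ω)) t
      = Complex.exp (-(((R i t).ofLp ⬝ᵥ S *ᵥ (R i t).ofLp : ℝ) : ℂ) / 2) := by
    intro i
    have e1 : P.map (fun ω => T i (ξ i ω)) = (multivariateGaussian 0 S).map (T i) := by
      rw [← (hξ i).map_eq, AEMeasurable.map_map_of_aemeasurable (hT i).aemeasurable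
        (hξ i).aemeasurable]
      rfl
    have e2 : charFun ((multivariateGaussian 0 S).map (T i)) t
        = charFun (multivariateGaussian 0 S) (R i t) := by
      rw [charFun_apply, charFun_apply, integral_map (hT i).aemeasurable (by fun_prop)]
      simp_rw [hTR]
    rw [e1, e2, charFun_multivariateGaussian hS]
    simp [neg_div]
  simp_rw [h1]
  rw [← Complex.exp_sum, ← Complex.ofReal_pow, ← hcov t]
  push_cast
  simp [Finset.sum_div, neg_div]

lemma hasLaw_real_preimage {E : Type*} [MeasurableSpace E] {μ : Measure E} {X : Ω → E}
    (hX : HasLaw X μ P) {s : Set E} (hs : MeasurableSet s) : P.real {ω | X ω ∈ s} = μ.real s := by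
  rw [measureReal_def, measureReal_def, ← hX.map_eq, Measure.map_apply_of_aemeasurable
    hX.aemeasurable hs]
  rfl

end Law

/-! ### Nets on the sphere -/

section Net

variable {E : Type*} [NormedAddCommGroup E] [InnerProductSpace ℝ E] [FiniteDimensional ℝ E]

/-- The unit sphere has a `1/2`-net with at most `5 ^ dim` points. -/
lemma exists_half_net_sphere : ∃ s : Finset E, s.card ≤ 5 ^ Module.finrank ℝ E ∧
    (∀ v ∈ s, ‖v‖ = 1) ∧ ∀ v : E, ‖v‖ = 1 → ∃ w ∈ s, ‖v - w‖ ≤ 1 / 2 := by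
  classical
  let good : Finset E → Prop := fun s =>
    (∀ v ∈ s, ‖v‖ = 1) ∧ ∀ v ∈ s, ∀ w ∈ s, v ≠ w → 1 / 2 ≤ ‖v - w‖
  have hcard : ∀ s, good s → s.card ≤ 5 ^ Module.finrank ℝ E := by
    intro s hs
    -- Doubling gives points of norm `2` at mutual distance at least `1`, the normalisation of
    -- `Besicovitch.card_le_of_separated`.
    have hinj : Function.Injective fun v : E => (2 : ℝ) • v := smul_right_injective E two_ne_zero
    rw [← Finset.card_image_of_injective s hinj]
    apply Besicovitch.card_le_of_separated
    · intro c hc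
      obtain ⟨v, hv, rfl⟩ := Finset.mem_image.1 hc
      simp [norm_smul, hs.1 v hv]
    · intro c hc c' hc' hne
      obtain ⟨v, hv, rfl⟩ := Finset.mem_image.1 hc
      obtain ⟨w, hw, rfl⟩ := Finset.mem_image.1 hc'
      have := hs.2 v hv w hw (fun h => hne (by rw [h]))
      rw [← smul_sub, norm_smul, Real.norm_eq_abs, abs_two]
      linarith
  -- A separated set of largest cardinality is a net, since an uncovered point could be added to it.
  let Q : Set ℕ := {k | ∃ s, good s ∧ s.card = k}
  have hQ : BddAbove Q := ⟨5 ^ Module.finrank ℝ E, by rintro _ ⟨s, hs, rfl⟩; exact hcard s hs⟩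
  have hQ0 : Q.Nonempty := ⟨0, ∅, by simp [good], rfl⟩
  obtain ⟨s, hs, hsk⟩ := Nat.sSup_mem hQ0 hQ
  refine ⟨s, hcard s hs, hs.1, fun v hv => ?_⟩
  by_contra! hfar
  have hvs : v ∉ s := fun h => by
    have := hfar v h
    simp at this
    linarith
  have hgood : good (insert v s) := by
    refine ⟨?_, ?_⟩
    · intro w hw
      rcases Finset.mem_insert.1 hw with rfl | hw
      exacts [hv, hs.1 w hw]
    · intro w hw z hz hne
      rcases Finset.mem_insert.1 hw with rfl | hw <;> rcases Finset.mem_insert.1 hz with rfl | hz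
      · exact absurd rfl hne
      · exact (hfar z ‹_›).le
      · rw [norm_sub_rev]; exact (hfar w ‹_›).le
      · exact hs.2 w ‹_› z ‹_› hne
  have := le_csSup hQ ⟨insert v s, hgood, rfl⟩
  rw [Finset.card_insert_of_notMem hvs, hsk] at this
  omega

variable {F : Type*} [NormedAddCommGroup F] [InnerProductSpace ℝ F]

/-- The triangle inequality would lose a factor `2`. Here the norm is attained at a top singular
vector `v₀`, for which `⟪G v₀, G w⟫ = N² ⟪v₀, w⟫`; hence `N ⟪v₀, w⟫ ≤ ‖G w‖`, and a net point within
`1/2` has `⟪v₀, w⟫ ≥ 7/8`. -/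
lemma norm_le_of_forall_mem_net {s : Finset E}
    (hnet : ∀ v : E, ‖v‖ = 1 → ∃ w ∈ s, ‖v - w‖ ≤ 1 / 2) (hs1 : ∀ w ∈ s, ‖w‖ = 1)
    (G : E →L[ℝ] F) {b : ℝ} (hb : 0 ≤ b) (hG : ∀ w ∈ s, ‖G w‖ ≤ b) (v : E) :
    ‖G v‖ ≤ 8 / 7 * b * ‖v‖ := by
  rcases subsingleton_or_nontrivial E with hE | hE
  · rw [Subsingleton.elim v 0]; simp
  obtain ⟨v₀, hv₀, hmax⟩ := (isCompact_sphere (0 : E) 1).exists_isMaxOn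
    (NormedSpace.sphere_nonempty.2 zero_le_one) (G.continuous.norm.continuousOn)
  have hv₀1 : ‖v₀‖ = 1 := by simpa using hv₀
  have hall : ∀ v, ‖G v‖ ≤ ‖G v₀‖ * ‖v‖ := by
    intro v
    rcases eq_or_ne v 0 with rfl | hv
    · simp
    have hn : 0 < ‖v‖ := norm_pos_iff.2 hv
    have h1 : ‖G (‖v‖⁻¹ • v)‖ ≤ ‖G v₀‖ := hmax (by
      simp [norm_smul, hn.ne'])
    rw [map_smul, norm_smul, norm_inv, norm_norm, inv_mul_le_iff₀ hn] at h1
    linarith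
  obtain ⟨w, hw, hvw⟩ := hnet v₀ hv₀1
  have hcos : 7 / 8 ≤ ⟪v₀, w⟫ := by
    have h1 := norm_sub_sq_real v₀ w
    rw [hv₀1, hs1 w hw] at h1
    have h2 : ‖v₀ - w‖ ^ 2 ≤ (1 / 2) ^ 2 := by gcongr
    linarith
  set N := ‖G v₀‖ with hN
  -- the top right singular vector `v₀` satisfies `G* G v₀ = N² v₀`
  have hsing : ⟪G v₀, G w⟫ = N ^ 2 * ⟪v₀, w⟫ := by
    have hpos : ∀ t : ℝ, 0 ≤ N ^ 2 * ‖v₀ + t • w‖ ^ 2 - ‖G (v₀ + t • w)‖ ^ 2 := by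
      intro t
      have := hall (v₀ + t • w)
      have h2 : ‖G (v₀ + t • w)‖ ^ 2 ≤ (N * ‖v₀ + t • w‖) ^ 2 := by gcongr
      linarith [mul_pow N ‖v₀ + t • w‖ 2]
    have hexp : ∀ t : ℝ, N ^ 2 * ‖v₀ + t • w‖ ^ 2 - ‖G (v₀ + t • w)‖ ^ 2
        = (N ^ 2 - ‖G w‖ ^ 2) * (t * t) + 2 * (N ^ 2 * ⟪v₀, w⟫ - ⟪G v₀, G w⟫) * t + 0 := by
      intro t
      rw [map_add, map_smul, norm_add_sq_real, norm_add_sq_real, inner_smul_right,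
        inner_smul_right, norm_smul, norm_smul, mul_pow, mul_pow, Real.norm_eq_abs, sq_abs,
        hv₀1, hs1 w hw, ← hN]
      ring
    -- A nonnegative quadratic in `t` without constant term has zero linear coefficient.
    have hd := discrim_le_zero (a := N ^ 2 - ‖G w‖ ^ 2)
      (b := 2 * (N ^ 2 * ⟪v₀, w⟫ - ⟪G v₀, G w⟫)) (c := 0)
      (fun t => by rw [← hexp t]; exact hpos t)
    rw [discrim] at hd
    nlinarith
  have hCS := real_inner_le_norm (G v₀) (G w)
  rw [hsing, ← hN] at hCS
  have hN0 : 0 ≤ N := norm_nonneg _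
  have hNb : N ≤ 8 / 7 * b := by
    rcases hN0.eq_or_lt with h0 | h0
    · rw [← h0]; positivity
    · have h1 : N * ⟪v₀, w⟫ ≤ ‖G w‖ := by
        refine le_of_mul_le_mul_left ?_ h0
        linarith
      have h2 := hG w hw
      nlinarith
  exact (hall v).trans (by gcongr)

/-- Approximate isometry on a `1/2`-net implies a lower bound on the whole space. -/
lemma le_norm_of_forall_mem_net {s : Finset E}
    (hnet : ∀ v : E, ‖v‖ = 1 → ∃ w ∈ s, ‖v - w‖ ≤ 1 / 2) (hs1 : ∀ w ∈ s, ‖w‖ = 1)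
    (G : E →L[ℝ] F) {a : ℝ} (ha : 0 ≤ a) (hGu : ∀ w ∈ s, ‖G w‖ ^ 2 ≤ a ^ 2 * (5 / 4))
    (hGl : ∀ w ∈ s, a ^ 2 * (3 / 4) ≤ ‖G w‖ ^ 2) (v : E) :
    1 / 5 * a * ‖v‖ ≤ ‖G v‖ := by
  have hup : ∀ v, ‖G v‖ ≤ 8 / 7 * (9 / 8 * a) * ‖v‖ := by
    refine norm_le_of_forall_mem_net hnet hs1 G (by positivity) fun w hw => ?_
    refine le_of_sq_le_sq ((hGu w hw).trans ?_) (by positivity)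
    nlinarith [sq_nonneg a]
  have hone : ∀ v : E, ‖v‖ = 1 → 1 / 5 * a ≤ ‖G v‖ := by
    intro v hv
    obtain ⟨w, hw, hvw⟩ := hnet v hv
    -- `43/50 ≤ √(3/4)`, while moving to the net point costs at most `9/14`; the difference exceeds
    -- `1/5`.
    have h1 : 43 / 50 * a ≤ ‖G w‖ := by
      refine le_of_sq_le_sq (le_trans ?_ (hGl w hw)) (norm_nonneg _)
      nlinarith [sq_nonneg a]
    have h2 := hup (v - w)
    have h3 : 8 / 7 * (9 / 8 * a) * ‖v - w‖ ≤ 8 / 7 * (9 / 8 * a) * (1 / 2) := by gcongr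
    have h4 : ‖G w‖ ≤ ‖G v‖ + ‖G (v - w)‖ := by
      rw [map_sub]
      have := norm_sub_le (G v) (G v - G w)
      simpa using this
    linarith
  rcases eq_or_ne v 0 with rfl | hv
  · simp
  have hn : 0 < ‖v‖ := norm_pos_iff.2 hv
  have h := hone (‖v‖⁻¹ • v) (by simp [norm_smul, hn.ne'])
  rw [map_smul, norm_smul, norm_inv, norm_norm] at h
  calc 1 / 5 * a * ‖v‖ ≤ ‖v‖⁻¹ * ‖G v‖ * ‖v‖ := by gcongr
    _ = ‖G v‖ := by field_simp

end Net

/-! ### Matrices as operators on Euclidean spaces -/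

section EuclideanMatrix

variable {m d p : ℕ}

lemma toEuclideanLin_mul_apply (A : Matrix (Fin m) (Fin d) ℝ) (B : Matrix (Fin d) (Fin p) ℝ)
    (v : EuclideanSpace ℝ (Fin p)) :
    Matrix.toEuclideanLin (A * B) v = Matrix.toEuclideanLin A (Matrix.toEuclideanLin B v) := by
  simp

lemma toEuclideanLin_one_apply (v : EuclideanSpace ℝ (Fin d)) :
    Matrix.toEuclideanLin (1 : Matrix (Fin d) (Fin d) ℝ) v = v := by
  simp

lemma inner_toEuclideanLin_left (A : Matrix (Fin m) (Fin d) ℝ) (v : EuclideanSpace ℝ (Fin d))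
    (u : EuclideanSpace ℝ (Fin m)) :
    ⟪Matrix.toEuclideanLin A v, u⟫ = ⟪v, Matrix.toEuclideanLin Aᵀ u⟫ := by
  rw [← Matrix.conjTranspose_eq_transpose_of_trivial,
    Matrix.toEuclideanLin_conjTranspose_eq_adjoint,
    LinearMap.adjoint_inner_right]

lemma norm_sq_toEuclideanLin_eq_inner (A : Matrix (Fin m) (Fin d) ℝ)
    (v : EuclideanSpace ℝ (Fin d)) :
    ‖Matrix.toEuclideanLin A v‖ ^ 2 = ⟪v, Matrix.toEuclideanLin (Aᵀ * A) v⟫ := by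
  rw [toEuclideanLin_mul_apply, ← inner_toEuclideanLin_left, real_inner_self_eq_norm_sq]

lemma dotProduct_mulVec_eq_inner (S : Matrix (Fin d) (Fin d) ℝ) (v : EuclideanSpace ℝ (Fin d)) :
    v.ofLp ⬝ᵥ S *ᵥ v.ofLp = ⟪v, Matrix.toEuclideanLin S v⟫ := by
  simp [Matrix.toLpLin_apply, PiLp.inner_apply, dotProduct, mul_comm]

-- The symmetric square root serves as `B`. It whitens the covariance of the design and
-- orthonormalises the columns of `X`.
open scoped MatrixOrder in
lemma exists_isUnit_transpose_mul_self_eq {S : Matrix (Fin d) (Fin d) ℝ} (hS : S.PosDef) :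
    ∃ B : Matrix (Fin d) (Fin d) ℝ, IsUnit B.det ∧ Bᵀ * B = S := by
  have h1 : CFC.sqrt S * CFC.sqrt S = S := CFC.sqrt_mul_sqrt_self _ hS.posSemidef.nonneg
  have h2 : (CFC.sqrt S)ᵀ = CFC.sqrt S := by
    rw [← Matrix.conjTranspose_eq_transpose_of_trivial]
    exact (CFC.sqrt_nonneg S).isSelfAdjoint
  refine ⟨CFC.sqrt S, ?_, by rw [h2, h1]⟩
  have h3 : (CFC.sqrt S).det * (CFC.sqrt S).det = S.det := by rw [← Matrix.det_mul, h1]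
  have h4 := hS.det_pos
  rw [isUnit_iff_ne_zero]
  intro h
  rw [h] at h3
  simp at h3
  linarith

lemma norm_toEuclideanLin_le_of_transpose (G : Matrix (Fin m) (Fin d) ℝ) {b : ℝ} (hb : 0 ≤ b)
    (h : ∀ u, ‖Matrix.toEuclideanLin Gᵀ u‖ ≤ b * ‖u‖) (v : EuclideanSpace ℝ (Fin d)) :
    ‖Matrix.toEuclideanLin G v‖ ≤ b * ‖v‖ := by
  set u := Matrix.toEuclideanLin G v with hu
  rcases eq_or_ne u 0 with h0 | h0
  · rw [h0, norm_zero]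
    positivity
  · have h1 : ‖u‖ ^ 2 ≤ ‖v‖ * (b * ‖u‖) := by
      rw [← real_inner_self_eq_norm_sq]
      nth_rw 1 [hu]
      rw [inner_toEuclideanLin_left]
      exact (real_inner_le_norm _ _).trans (by gcongr; exact h u)
    have : 0 < ‖u‖ := norm_pos_iff.2 h0
    refine le_of_mul_le_mul_right ?_ this
    linarith [sq ‖u‖]

end EuclideanMatrix

/-! ### Union bounds for random operators -/

section RandomOperator

variable {Ω : Type*} [MeasurableSpace Ω] {P : Measure Ω} [IsProbabilityMeasure P] {l m : ℕ}

/-- Operator norm bound for a random operator whose value at each unit vector is a standard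
Gaussian vector. -/
lemma real_not_norm_le_le (G : Ω → Matrix (Fin m) (Fin l) ℝ)
    (hG : ∀ v, ‖v‖ = 1 → HasLaw (fun ω => Matrix.toEuclideanLin (G ω) v)
      (stdGaussian (EuclideanSpace ℝ (Fin m))) P) (hm : 0 < m) {t : ℝ} (ht : 0 ≤ t) :
    P.real {ω | ¬ ∀ v, ‖Matrix.toEuclideanLin (G ω) v‖ ≤ 8 / 7 * (√m + t) * ‖v‖}
      ≤ 5 ^ l * Real.exp (-(t ^ 2 / 2)) := by
  obtain ⟨s, hcard, hs1, hnet⟩ := exists_half_net_sphere (E := EuclideanSpace ℝ (Fin l))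
  rw [finrank_euclideanSpace_fin] at hcard
  calc P.real {ω | ¬ ∀ v, ‖Matrix.toEuclideanLin (G ω) v‖ ≤ 8 / 7 * (√m + t) * ‖v‖}
      ≤ P.real (⋃ w ∈ s, {ω | Matrix.toEuclideanLin (G ω) w ∈ {x | √m + t ≤ ‖x‖}}) := by
        refine measureReal_mono (fun ω hω => ?_) (measure_ne_top _ _)
        by_contra hcon
        refine hω fun v => ?_
        refine norm_le_of_forall_mem_net hnet hs1
          (LinearMap.toContinuousLinearMap (Matrix.toEuclideanLin (G ω))) (by positivity)
          (fun w hw => ?_) v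
        by_contra! hlt
        exact hcon (Set.mem_biUnion hw hlt.le)
    _ ≤ ∑ w ∈ s, P.real {ω | Matrix.toEuclideanLin (G ω) w ∈ {x | √m + t ≤ ‖x‖}} :=
        measureReal_biUnion_finset_le _ _
    _ ≤ ∑ w ∈ s, Real.exp (-(t ^ 2 / 2)) := by
        refine Finset.sum_le_sum fun w hw => ?_
        rw [hasLaw_real_preimage (hG w (hs1 w hw))
          (measurableSet_le measurable_const measurable_norm)]
        exact stdGaussian_real_norm_ge_le hm ht
    _ ≤ 5 ^ l * Real.exp (-(t ^ 2 / 2)) := by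
        rw [Finset.sum_const, nsmul_eq_mul]
        gcongr
        exact_mod_cast hcard

lemma real_not_le_norm_le (G : Ω → Matrix (Fin m) (Fin l) ℝ)
    (hG : ∀ v, ‖v‖ = 1 → HasLaw (fun ω => Matrix.toEuclideanLin (G ω) v)
      (stdGaussian (EuclideanSpace ℝ (Fin m))) P) :
    P.real {ω | ¬ ∀ v, 1 / 5 * √m * ‖v‖ ≤ ‖Matrix.toEuclideanLin (G ω) v‖}
      ≤ 2 * (5 ^ l * Real.exp (-(m / 100))) := by
  obtain ⟨s, hcard, hs1, hnet⟩ := exists_half_net_sphere (E := EuclideanSpace ℝ (Fin l))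
  rw [finrank_euclideanSpace_fin] at hcard
  have hmm : √(m : ℝ) ^ 2 = m := Real.sq_sqrt (by positivity)
  let U : Set (EuclideanSpace ℝ (Fin m)) := {x | m * (5 / 4) ≤ ‖x‖ ^ 2}
  let D : Set (EuclideanSpace ℝ (Fin m)) := {x | ‖x‖ ^ 2 ≤ m * (3 / 4)}
  have hU : MeasurableSet U := measurableSet_le (by fun_prop) (by fun_prop)
  have hD : MeasurableSet D := measurableSet_le (by fun_prop) (by fun_prop)
  calc P.real {ω | ¬ ∀ v, 1 / 5 * √m * ‖v‖ ≤ ‖Matrix.toEuclideanLin (G ω) v‖}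
      ≤ P.real (⋃ w ∈ s, ({ω | Matrix.toEuclideanLin (G ω) w ∈ U} ∪
          {ω | Matrix.toEuclideanLin (G ω) w ∈ D})) := by
        refine measureReal_mono (fun ω hω => ?_) (measure_ne_top _ _)
        by_contra hcon
        refine hω fun v => ?_
        refine le_norm_of_forall_mem_net hnet hs1
          (LinearMap.toContinuousLinearMap (Matrix.toEuclideanLin (G ω))) (by positivity)
          (fun w hw => ?_) (fun w hw => ?_) v
        · by_contra! hlt
          rw [hmm] at hlt
          exact hcon (Set.mem_biUnion hw (Or.inl hlt.le))
        · by_contra! hlt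
          rw [hmm] at hlt
          exact hcon (Set.mem_biUnion hw (Or.inr hlt.le))
    _ ≤ ∑ w ∈ s, P.real ({ω | Matrix.toEuclideanLin (G ω) w ∈ U} ∪
          {ω | Matrix.toEuclideanLin (G ω) w ∈ D}) :=
        measureReal_biUnion_finset_le _ _
    _ ≤ ∑ w ∈ s, 2 * Real.exp (-(m / 100)) := by
        refine Finset.sum_le_sum fun w hw => ?_
        refine (measureReal_union_le _ _).trans ?_
        rw [hasLaw_real_preimage (hG w (hs1 w hw)) hU, hasLaw_real_preimage (hG w (hs1 w hw)) hD]
        linarith [stdGaussian_real_norm_sq_ge_le (m := m), stdGaussian_real_norm_sq_le_le (m := m)]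
    _ ≤ 2 * (5 ^ l * Real.exp (-(m / 100))) := by
        rw [Finset.sum_const, nsmul_eq_mul, mul_left_comm]
        gcongr
        exact_mod_cast hcard

end RandomOperator

/-! ### Laws of the whitened design and of the projected noise -/

section Data

variable {Ω : Type*} [MeasurableSpace Ω] {P : Measure Ω} [IsProbabilityMeasure P] {n d p : ℕ}

/-- Lower isometry bound for a Gaussian design with covariance `Bᵀ B`. -/
lemma design_real_not_le_norm_le {B : Matrix (Fin d) (Fin d) ℝ} (hB : IsUnit B.det)
    {x : Fin n → Ω → EuclideanSpace ℝ (Fin d)}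
    (hx : ∀ i, HasLaw (x i) (multivariateGaussian 0 (Bᵀ * B)) P) (hind : iIndepFun x P) :
    P.real {ω | ¬ ∀ w, 1 / 5 * √n * ‖Matrix.toEuclideanLin B w‖
        ≤ ‖Matrix.toEuclideanLin (dataMatrix fun i => x i ω) w‖}
      ≤ 2 * (5 ^ d * Real.exp (-(n / 100))) := by
  have hS : (Bᵀ * B).PosSemidef := by
    rw [← Matrix.conjTranspose_eq_transpose_of_trivial]
    exact Matrix.posSemidef_conjTranspose_mul_self B
  have hBB : ∀ v, Matrix.toEuclideanLin B (Matrix.toEuclideanLin B⁻¹ v) = v := fun v => by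
    rw [← toEuclideanLin_mul_apply, Matrix.mul_nonsing_inv _ hB, toEuclideanLin_one_apply]
  have key := real_not_le_norm_le (P := P) (fun ω => (dataMatrix fun i => x i ω) * B⁻¹) ?_
  · refine (measureReal_mono (fun ω hω => ?_) (measure_ne_top _ _)).trans key
    simp only [Set.mem_ofPred_eq] at hω ⊢
    refine fun hcon => hω fun w => ?_
    have := hcon (Matrix.toEuclideanLin B w)
    rwa [toEuclideanLin_mul_apply, ← toEuclideanLin_mul_apply B⁻¹ B,
      Matrix.nonsing_inv_mul _ hB, toEuclideanLin_one_apply] at this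
  · intro v hv
    set z := Matrix.toEuclideanLin B⁻¹ v with hz
    have h := hasLaw_sum_stdGaussian hS hx hind
      (fun i ξ => ⟪z, ξ⟫ • (EuclideanSpace.single i 1 : EuclideanSpace ℝ (Fin n)))
      (fun i => by fun_prop) (fun i t => t i • z)
      (fun i ξ t => by
        rw [inner_smul_left, inner_smul_right, EuclideanSpace.inner_single_left]
        simp [real_inner_comm, mul_comm]) ?_
    · refine h.congr (.of_forall fun ω => ?_)
      ext j
      beta_reduce
      rw [toEuclideanLin_mul_apply, ← hz]
      simp [Matrix.toLpLin_apply, dataMatrix, Matrix.mulVec, dotProduct, PiLp.inner_apply,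
        Pi.single_apply, mul_comm]
    · intro t
      have h1 : ⟪z, Matrix.toEuclideanLin (Bᵀ * B) z⟫ = 1 := by
        rw [← norm_sq_toEuclideanLin_eq_inner, hz, hBB, hv]; norm_num
      simp_rw [dotProduct_mulVec_eq_inner, map_smul, inner_smul_left, inner_smul_right, h1]
      rw [EuclideanSpace.real_norm_sq_eq]
      simp [sq]

lemma scalar_posSemidef (σ : ℝ) : (σ ^ 2 • (1 : Matrix (Fin p) (Fin p) ℝ)).PosSemidef :=
  Matrix.PosSemidef.one.smul (sq_nonneg σ)

lemma dotProduct_scalar_mulVec (σ : ℝ) (v : EuclideanSpace ℝ (Fin p)) :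
    v.ofLp ⬝ᵥ (σ ^ 2 • (1 : Matrix (Fin p) (Fin p) ℝ)) *ᵥ v.ofLp = σ ^ 2 * ‖v‖ ^ 2 := by
  rw [Matrix.smul_mulVec, Matrix.one_mulVec, dotProduct_smul, EuclideanSpace.real_norm_sq_eq]
  simp [dotProduct, sq]

variable {σ : ℝ} {η : Fin n → Ω → EuclideanSpace ℝ (Fin p)}

/-- For a matrix `U` with orthonormal columns, `Nᵀ U v` is standard Gaussian for unit `v`. -/
lemma hasLaw_noise_transpose_mul (hσ : 0 < σ)
    (hη : ∀ i, HasLaw (η i) (multivariateGaussian 0 (σ ^ 2 • (1 : Matrix (Fin p) (Fin p) ℝ))) P)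
    (hind : iIndepFun η P) {U : Matrix (Fin n) (Fin d) ℝ} (hU : Uᵀ * U = 1)
    (v : EuclideanSpace ℝ (Fin d)) (hv : ‖v‖ = 1) :
    HasLaw (fun ω => Matrix.toEuclideanLin (σ⁻¹ • ((dataMatrix fun i => η i ω)ᵀ * U)) v)
      (stdGaussian (EuclideanSpace ℝ (Fin p))) P := by
  set a := Matrix.toEuclideanLin U v with ha
  have ha1 : ‖a‖ ^ 2 = 1 := by
    rw [ha, norm_sq_toEuclideanLin_eq_inner, hU, toEuclideanLin_one_apply,
      real_inner_self_eq_norm_sq, hv, one_pow]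
  have h := hasLaw_sum_stdGaussian (scalar_posSemidef σ) hη hind
    (fun i ξ => (σ⁻¹ * a i) • ξ) (fun i => by fun_prop) (fun i t => (σ⁻¹ * a i) • t)
    (fun i ξ t => by rw [inner_smul_left, inner_smul_right]; simp) ?_
  · refine h.congr (.of_forall fun ω => ?_)
    ext j
    beta_reduce
    rw [map_smul, LinearMap.smul_apply, toEuclideanLin_mul_apply, ← ha]
    simp [Matrix.toLpLin_apply, dataMatrix, Matrix.mulVec, dotProduct, Finset.mul_sum]
    exact Finset.sum_congr rfl fun i _ => by ring
  · intro t
    simp_rw [dotProduct_scalar_mulVec, norm_smul, mul_pow, Real.norm_eq_abs, sq_abs, mul_pow]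
    calc ∑ i, σ ^ 2 * (σ⁻¹ ^ 2 * a i ^ 2 * ‖t‖ ^ 2) = (∑ i, a i ^ 2) * ‖t‖ ^ 2 := by
          rw [Finset.sum_mul]
          exact Finset.sum_congr rfl fun i _ => by field_simp
      _ = ‖t‖ ^ 2 := by rw [← EuclideanSpace.real_norm_sq_eq, ha1, one_mul]

/-- For a matrix `U` with orthonormal columns, `Uᵀ N u` is standard Gaussian for unit `u`. -/
lemma hasLaw_transpose_mul_noise (hσ : 0 < σ)
    (hη : ∀ i, HasLaw (η i) (multivariateGaussian 0 (σ ^ 2 • (1 : Matrix (Fin p) (Fin p) ℝ))) P)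
    (hind : iIndepFun η P) {U : Matrix (Fin n) (Fin d) ℝ} (hU : Uᵀ * U = 1)
    (u : EuclideanSpace ℝ (Fin p)) (hu : ‖u‖ = 1) :
    HasLaw (fun ω => Matrix.toEuclideanLin (σ⁻¹ • ((dataMatrix fun i => η i ω)ᵀ * U))ᵀ u)
      (stdGaussian (EuclideanSpace ℝ (Fin d))) P := by
  let row : Fin n → EuclideanSpace ℝ (Fin d) := fun i => WithLp.toLp 2 (U i)
  have hrow : ∀ t, ∑ i, ⟪row i, t⟫ ^ 2 = ‖t‖ ^ 2 := by
    intro t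
    have h1 : ‖Matrix.toEuclideanLin U t‖ ^ 2 = ‖t‖ ^ 2 := by
      rw [norm_sq_toEuclideanLin_eq_inner, hU, toEuclideanLin_one_apply,
        real_inner_self_eq_norm_sq]
    rw [← h1, EuclideanSpace.real_norm_sq_eq]
    refine Finset.sum_congr rfl fun i _ => ?_
    simp [row, Matrix.toLpLin_apply, Matrix.mulVec, dotProduct, PiLp.inner_apply, mul_comm]
  have h := hasLaw_sum_stdGaussian (scalar_posSemidef σ) hη hind
    (fun i ξ => (σ⁻¹ * ⟪u, ξ⟫) • row i) (fun i => by fun_prop)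
    (fun i t => (σ⁻¹ * ⟪row i, t⟫) • u)
    (fun i ξ t => by
      rw [inner_smul_left, inner_smul_right, real_inner_comm u ξ]
      simp only [conj_trivial]
      ring) ?_
  · refine h.congr (.of_forall fun ω => ?_)
    ext j
    beta_reduce
    rw [Matrix.transpose_smul, Matrix.transpose_mul, Matrix.transpose_transpose, map_smul,
      LinearMap.smul_apply, toEuclideanLin_mul_apply]
    simp [row, Matrix.toLpLin_apply, dataMatrix, Matrix.mulVec, dotProduct, PiLp.inner_apply,
      Finset.mul_sum, Finset.sum_mul, -Matrix.mulVec_mulVec]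
    exact Finset.sum_congr rfl fun i _ => Finset.sum_congr rfl fun k _ => by ring
  · intro t
    simp_rw [dotProduct_scalar_mulVec, norm_smul, hu, mul_one, Real.norm_eq_abs, sq_abs, mul_pow]
    calc ∑ i, σ ^ 2 * (σ⁻¹ ^ 2 * ⟪row i, t⟫ ^ 2) = ∑ i, ⟪row i, t⟫ ^ 2 :=
          Finset.sum_congr rfl fun i _ => by field_simp
      _ = ‖t‖ ^ 2 := hrow t

end Data

/-! ### Numerical constants -/

section Constants

lemma five_pow_le_exp (l : ℕ) : (5 : ℝ) ^ l ≤ Real.exp (5 / 3 * l) := by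
  have h1 : (5 : ℝ) ^ 3 ≤ Real.exp (5 / 3) ^ 3 := by
    rw [← Real.exp_nat_mul]
    have h2 := Real.exp_one_gt_d9
    have h3 : Real.exp ((3 : ℕ) * (5 / 3)) = Real.exp 1 ^ 5 := by
      rw [← Real.exp_nat_mul]; norm_num
    rw [h3]
    calc (5 : ℝ) ^ 3 ≤ 2.7 ^ 5 := by norm_num
      _ ≤ Real.exp 1 ^ 5 := by gcongr; linarith
  have h4 : (5 : ℝ) ≤ Real.exp (5 / 3) := le_of_pow_le_pow_left₀ (by norm_num) (by positivity) h1
  calc (5 : ℝ) ^ l ≤ Real.exp (5 / 3) ^ l := by gcongr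
    _ = Real.exp (5 / 3 * l) := by rw [← Real.exp_nat_mul, mul_comm]

lemma log_one_div_nonneg {δ : ℝ} (hδ : δ ∈ Set.Ioo (0 : ℝ) 1) : 0 ≤ Real.log (1 / δ) :=
  Real.log_nonneg (by rw [le_div_iff₀ hδ.1]; linarith [hδ.2])

lemma exp_neg_log_one_div {δ : ℝ} (hδ : δ ∈ Set.Ioo (0 : ℝ) 1) :
    Real.exp (-Real.log (1 / δ)) = δ := by
  rw [one_div, Real.log_inv, neg_neg, Real.exp_log hδ.1]

lemma five_pow_mul_exp_le {l : ℕ} (hl : 0 < l) {δ : ℝ} (hδ : δ ∈ Set.Ioo (0 : ℝ) 1) :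
    5 ^ l * Real.exp (-((11 / 5 * √l + 3 / 2 * √(Real.log (1 / δ))) ^ 2 / 2)) ≤ δ / 2 := by
  set L := Real.log (1 / δ) with hL
  have hL0 : 0 ≤ L := log_one_div_nonneg hδ
  have hl1 : (1 : ℝ) ≤ l := by exact_mod_cast hl
  have h1 : √(l : ℝ) ^ 2 = l := Real.sq_sqrt (by positivity)
  have h2 : √L ^ 2 = L := Real.sq_sqrt hL0
  have h3 : 0 ≤ √(l : ℝ) * √L := by positivity
  calc 5 ^ l * Real.exp (-((11 / 5 * √l + 3 / 2 * √L) ^ 2 / 2))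
      ≤ Real.exp (5 / 3 * l) * Real.exp (-((11 / 5 * √l + 3 / 2 * √L) ^ 2 / 2)) := by
        gcongr; exact five_pow_le_exp l
    _ = Real.exp (5 / 3 * l - (11 / 5 * √l + 3 / 2 * √L) ^ 2 / 2) := by
        rw [← Real.exp_add, sub_eq_add_neg]
    _ ≤ Real.exp (-L + -(3 / 4)) := by
        apply Real.exp_le_exp.2
        -- The square gives `(11/5)²/2 - 5/3 > 3/4` per dimension and `9/8 ≥ 1` in front of `L`; the
        -- cross term is nonnegative.
        nlinarith
    _ = δ * Real.exp (-(3 / 4)) := by rw [Real.exp_add, hL, exp_neg_log_one_div hδ]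
    _ ≤ δ * (1 / 2) := by
        have h4 : (2 : ℝ) ≤ Real.exp (3 / 4) := by
          have := Real.quadratic_le_exp_of_nonneg (x := 3 / 4) (by norm_num)
          linarith
        rw [Real.exp_neg]
        have h5 : (Real.exp (3 / 4))⁻¹ ≤ 2⁻¹ := inv_anti₀ (by norm_num) h4
        have := hδ.1.le
        gcongr
        linarith
    _ = δ / 2 := by ring

lemma two_mul_five_pow_mul_exp_le {d n : ℕ} (hd : 0 < d) {δ : ℝ} (hδ : δ ∈ Set.Ioo (0 : ℝ) 1)
    (hn : 1000 * ((d : ℝ) + Real.log (1 / δ)) ≤ n) :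
    2 * (5 ^ d * Real.exp (-((n : ℝ) / 100))) ≤ δ / 2 := by
  set L := Real.log (1 / δ) with hL
  have hL0 : 0 ≤ L := log_one_div_nonneg hδ
  have hd1 : (1 : ℝ) ≤ d := by exact_mod_cast hd
  calc 2 * (5 ^ d * Real.exp (-((n : ℝ) / 100)))
      ≤ 2 * (Real.exp (5 / 3 * d) * Real.exp (-((n : ℝ) / 100))) := by
        gcongr; exact five_pow_le_exp d
    _ = 2 * Real.exp (5 / 3 * d - n / 100) := by rw [← Real.exp_add, sub_eq_add_neg]
    _ ≤ 2 * Real.exp (-L + -3) := by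
        gcongr
        linarith
    _ = δ * (2 * Real.exp (-3)) := by rw [Real.exp_add, hL, exp_neg_log_one_div hδ]; ring
    _ ≤ δ * (1 / 2) := by
        have h4 : (4 : ℝ) ≤ Real.exp 3 := by linarith [Real.add_one_le_exp (3 : ℝ)]
        rw [Real.exp_neg]
        have h5 : (Real.exp 3)⁻¹ ≤ 4⁻¹ := inv_anti₀ (by norm_num) h4
        have := hδ.1.le
        gcongr
        linarith
    _ = δ / 2 := by ring

lemma eight_sevenths_mul_le {l m : ℕ} (hlm : l ≤ m) (L : ℝ) :
    8 / 7 * (√m + (11 / 5 * √l + 3 / 2 * √L)) ≤ 19 / 10 * (√l + √m + √L) := by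
  have h1 : √(l : ℝ) ≤ √(m : ℝ) := Real.sqrt_le_sqrt (by exact_mod_cast hlm)
  linarith [Real.sqrt_nonneg L, Real.sqrt_nonneg (l : ℝ)]

end Constants

/-! ### Noise bound, for fixed and then for random design -/

section Noise

variable {Ω : Type*} [MeasurableSpace Ω] {P : Measure Ω} [IsProbabilityMeasure P] {n d p : ℕ}
  {σ : ℝ} {η : Fin n → Ω → EuclideanSpace ℝ (Fin p)}

/-- The net is taken on the side of smaller dimension, passing to the transpose if necessary;
`eight_sevenths_mul_le` needs this to stay below `19/10`. -/
lemma noise_orthonormal_real_not_le (hd : 0 < d) (hp : 0 < p) (hσ : 0 < σ)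
    (hη : ∀ i, HasLaw (η i) (multivariateGaussian 0 (σ ^ 2 • (1 : Matrix (Fin p) (Fin p) ℝ))) P)
    (hind : iIndepFun η P) {δ : ℝ} (hδ : δ ∈ Set.Ioo (0 : ℝ) 1)
    {U : Matrix (Fin n) (Fin d) ℝ} (hU : Uᵀ * U = 1) :
    P.real {ω | ¬ ∀ v, ‖Matrix.toEuclideanLin (σ⁻¹ • ((dataMatrix fun i => η i ω)ᵀ * U)) v‖
      ≤ 19 / 10 * (√d + √p + √(Real.log (1 / δ))) * ‖v‖} ≤ δ / 2 := by
  rcases le_total d p with h | h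
  · refine (measureReal_mono (fun ω hω => ?_) (measure_ne_top _ _)).trans
      ((real_not_norm_le_le _ (hasLaw_noise_transpose_mul hσ hη hind hU) hp
        (t := 11 / 5 * √d + 3 / 2 * √(Real.log (1 / δ))) (by positivity)).trans
        (five_pow_mul_exp_le hd hδ))
    simp only [Set.mem_ofPred_eq] at hω ⊢
    refine fun hcon => hω fun v => (hcon v).trans ?_
    refine mul_le_mul_of_nonneg_right ?_ (norm_nonneg _)
    exact eight_sevenths_mul_le h _
  · refine (measureReal_mono (fun ω hω => ?_) (measure_ne_top _ _)).trans
      ((real_not_norm_le_le _ (hasLaw_transpose_mul_noise hσ hη hind hU) hd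
        (t := 11 / 5 * √p + 3 / 2 * √(Real.log (1 / δ))) (by positivity)).trans
        (five_pow_mul_exp_le hp hδ))
    simp only [Set.mem_ofPred_eq] at hω ⊢
    refine fun hcon => hω (norm_toEuclideanLin_le_of_transpose _ (by positivity)
      fun u => (hcon u).trans ?_)
    refine mul_le_mul_of_nonneg_right ?_ (norm_nonneg _)
    rw [add_comm √(d : ℝ) √(p : ℝ)]
    exact eight_sevenths_mul_le h _

/-- For a fixed design, the noise projected on the range of `X` is small in operator norm. -/
lemma noise_real_not_le (hd : 0 < d) (hp : 0 < p) (hσ : 0 < σ)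
    (hη : ∀ i, HasLaw (η i) (multivariateGaussian 0 (σ ^ 2 • (1 : Matrix (Fin p) (Fin p) ℝ))) P)
    (hind : iIndepFun η P) {δ : ℝ} (hδ : δ ∈ Set.Ioo (0 : ℝ) 1)
    (X : Matrix (Fin n) (Fin d) ℝ) (hX : (Xᵀ * X).det ≠ 0) :
    P.real {ω | ¬ ∀ w, ‖Matrix.toEuclideanLin ((dataMatrix fun i => η i ω)ᵀ * X) w‖
      ≤ σ * (19 / 10 * (√d + √p + √(Real.log (1 / δ)))) * ‖Matrix.toEuclideanLin X w‖}
      ≤ δ / 2 := by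
  have hpos : (Xᵀ * X).PosDef := by
    have h1 : (Xᵀ * X).PosSemidef := by
      rw [← Matrix.conjTranspose_eq_transpose_of_trivial]
      exact Matrix.posSemidef_conjTranspose_mul_self X
    exact h1.posDef_iff_isUnit.2 ((Matrix.isUnit_iff_isUnit_det _).2 (isUnit_iff_ne_zero.2 hX))
  obtain ⟨B, hB, hBX⟩ := exists_isUnit_transpose_mul_self_eq hpos
  -- Since `Bᵀ B = Xᵀ X`, the columns of `X B⁻¹` are orthonormal and `‖B w‖ = ‖X w‖`.
  have hU : (X * B⁻¹)ᵀ * (X * B⁻¹) = 1 := by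
    have hBt : IsUnit Bᵀ.det := by rwa [Matrix.det_transpose]
    calc (X * B⁻¹)ᵀ * (X * B⁻¹) = B⁻¹ᵀ * (Xᵀ * X) * B⁻¹ := by
          rw [Matrix.transpose_mul]; simp only [Matrix.mul_assoc]
      _ = (Bᵀ⁻¹ * Bᵀ) * (B * B⁻¹) := by
          rw [← hBX, Matrix.transpose_nonsing_inv]; simp only [Matrix.mul_assoc]
      _ = 1 := by rw [Matrix.nonsing_inv_mul _ hBt, Matrix.mul_nonsing_inv _ hB, one_mul]
  have hnorm : ∀ w, ‖Matrix.toEuclideanLin B w‖ = ‖Matrix.toEuclideanLin X w‖ := fun w => by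
    rw [← sq_eq_sq₀ (norm_nonneg _) (norm_nonneg _), norm_sq_toEuclideanLin_eq_inner, hBX,
      ← norm_sq_toEuclideanLin_eq_inner]
  refine (measureReal_mono (fun ω hω => ?_) (measure_ne_top _ _)).trans
    (noise_orthonormal_real_not_le hd hp hσ hη hind hδ hU)
  simp only [Set.mem_ofPred_eq] at hω ⊢
  refine fun hcon => hω fun w => ?_
  have h := hcon (Matrix.toEuclideanLin B w)
  rw [map_smul, LinearMap.smul_apply, ← toEuclideanLin_mul_apply, norm_smul, Real.norm_eq_abs,
    abs_of_pos (inv_pos.2 hσ), inv_mul_le_iff₀ hσ, Matrix.mul_assoc, Matrix.mul_assoc,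
    Matrix.nonsing_inv_mul _ hB, Matrix.mul_one, hnorm] at h
  linarith

/-- By independence the joint law is a product, so Tonelli integrates a bound that is uniform over
frozen `x`. -/
lemma real_le_of_indepFun {𝓧 𝓨 : Type*} [MeasurableSpace 𝓧] [MeasurableSpace 𝓨]
    {X : Ω → 𝓧} {Y : Ω → 𝓨} (hX : AEMeasurable X P) (hY : AEMeasurable Y P)
    (hXY : IndepFun X Y P) {s : Set (𝓧 × 𝓨)} (hs : MeasurableSet s) {c : ℝ}
    (h : ∀ x, P.real {ω | (x, Y ω) ∈ s} ≤ c) : P.real {ω | (X ω, Y ω) ∈ s} ≤ c := by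
  have hc : 0 ≤ c := by
    have : Nonempty Ω := nonempty_of_isProbabilityMeasure P
    exact measureReal_nonneg.trans (h (X (Classical.arbitrary Ω)))
  have : IsProbabilityMeasure (P.map X) := Measure.isProbabilityMeasure_map hX
  have : IsProbabilityMeasure (P.map Y) := Measure.isProbabilityMeasure_map hY
  refine ENNReal.toReal_le_of_le_ofReal hc ?_
  have e : P {ω | (X ω, Y ω) ∈ s} = ((P.map X).prod (P.map Y)) s := by
    rw [← (indepFun_iff_map_prod_eq_prod_map_map hX hY).1 hXY,
      Measure.map_apply_of_aemeasurable (hX.prodMk hY) hs]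
    rfl
  rw [e, Measure.prod_apply hs]
  calc ∫⁻ x, (P.map Y) (Prod.mk x ⁻¹' s) ∂(P.map X) ≤ ∫⁻ _, ENNReal.ofReal c ∂(P.map X) := by
        refine lintegral_mono fun x => ?_
        rw [Measure.map_apply_of_aemeasurable hY (measurable_prodMk_left hs)]
        exact (ENNReal.le_ofReal_iff_toReal_le (measure_ne_top _ _) hc).2 (h x)
    _ = ENNReal.ofReal c := by simp

lemma continuous_dataMatrix :
    Continuous (dataMatrix : (Fin n → EuclideanSpace ℝ (Fin d)) → Matrix (Fin n) (Fin d) ℝ) := by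
  unfold dataMatrix
  fun_prop

lemma noise_real_not_le_of_indepFun (hd : 0 < d) (hp : 0 < p) (hσ : 0 < σ)
    (hη : ∀ i, HasLaw (η i) (multivariateGaussian 0 (σ ^ 2 • (1 : Matrix (Fin p) (Fin p) ℝ))) P)
    (hind : iIndepFun η P) {δ : ℝ} (hδ : δ ∈ Set.Ioo (0 : ℝ) 1)
    {x : Fin n → Ω → EuclideanSpace ℝ (Fin d)} (hx : ∀ i, AEMeasurable (x i) P)
    (hxη : IndepFun (fun ω i => x i ω) (fun ω i => η i ω) P) :
    P.real {ω | ((dataMatrix fun i => x i ω)ᵀ * dataMatrix fun i => x i ω).det ≠ 0 ∧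
      ¬ ∀ w, ‖Matrix.toEuclideanLin ((dataMatrix fun i => η i ω)ᵀ * dataMatrix fun i => x i ω) w‖
        ≤ σ * (19 / 10 * (√d + √p + √(Real.log (1 / δ)))) *
          ‖Matrix.toEuclideanLin (dataMatrix fun i => x i ω) w‖}
      ≤ δ / 2 := by
  set b := σ * (19 / 10 * (√(d : ℝ) + √(p : ℝ) + √(Real.log (1 / δ))))
  let s : Set ((Fin n → EuclideanSpace ℝ (Fin d)) × (Fin n → EuclideanSpace ℝ (Fin p))) :=
    {z | ((dataMatrix z.1)ᵀ * dataMatrix z.1).det ≠ 0 ∧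
      ¬ ∀ w, ‖Matrix.toEuclideanLin ((dataMatrix z.2)ᵀ * dataMatrix z.1) w‖
        ≤ b * ‖Matrix.toEuclideanLin (dataMatrix z.1) w‖}
  have hc1 : Continuous fun z : (Fin n → EuclideanSpace ℝ (Fin d)) ×
      (Fin n → EuclideanSpace ℝ (Fin p)) => dataMatrix z.1 :=
    continuous_dataMatrix.comp continuous_fst
  have hc2 : Continuous fun z : (Fin n → EuclideanSpace ℝ (Fin d)) ×
      (Fin n → EuclideanSpace ℝ (Fin p)) => dataMatrix z.2 :=
    continuous_dataMatrix.comp continuous_snd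
  have hs : MeasurableSet s := by
    refine MeasurableSet.inter (IsOpen.measurableSet ?_)
      (MeasurableSet.compl (IsClosed.measurableSet ?_))
    · exact isOpen_ne.preimage (hc1.matrix_transpose.matrix_mul hc1).matrix_det
    · have hlin : ∀ {a c : ℕ} (w : EuclideanSpace ℝ (Fin c)),
          Continuous fun M : Matrix (Fin a) (Fin c) ℝ => Matrix.toEuclideanLin M w := by
        intro a c w
        exact LinearMap.continuous_of_finiteDimensional
          ((LinearMap.applyₗ w).comp (Matrix.toEuclideanLin :
            Matrix (Fin a) (Fin c) ℝ ≃ₗ[ℝ] _).toLinearMap)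
      -- The intersection over `w` is uncountable, so measurability goes through closedness.
      have : ({z | ∀ w, ‖Matrix.toEuclideanLin ((dataMatrix z.2)ᵀ * dataMatrix z.1) w‖
          ≤ b * ‖Matrix.toEuclideanLin (dataMatrix z.1) w‖} :
          Set ((Fin n → EuclideanSpace ℝ (Fin d)) × (Fin n → EuclideanSpace ℝ (Fin p)))) =
          ⋂ w, {z | ‖Matrix.toEuclideanLin ((dataMatrix z.2)ᵀ * dataMatrix z.1) w‖
          ≤ b * ‖Matrix.toEuclideanLin (dataMatrix z.1) w‖} := by
        ext z; simp
      change IsClosed {z | ∀ w, _}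
      rw [this]
      refine isClosed_iInter fun w => isClosed_le ?_ ?_
      · exact ((hlin w).comp (hc2.matrix_transpose.matrix_mul hc1)).norm
      · exact continuous_const.mul ((hlin w).comp hc1).norm
  refine real_le_of_indepFun (X := fun ω i => x i ω) (Y := fun ω i => η i ω)
    (aemeasurable_pi_lambda _ hx) (aemeasurable_pi_lambda _ fun i => (hη i).aemeasurable)
    hxη hs fun z => ?_
  by_cases hz : ((dataMatrix z)ᵀ * dataMatrix z).det = 0
  · have : {ω | (z, fun i => η i ω) ∈ s} = ∅ := by
      ext ω
      simp [s, hz]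
    rw [this, measureReal_empty]
    linarith [hδ.1]
  · refine (measureReal_mono (fun ω hω => ?_) (measure_ne_top _ _)).trans
      (noise_real_not_le hd hp hσ hη hind hδ (dataMatrix z) hz)
    exact hω.2

end Noise

/-! ### Variational bounds for the smallest eigenvalue -/

section LambdaMin

variable {d : ℕ}

lemma inner_toEuclideanLin_eq_sum {S : Matrix (Fin d) (Fin d) ℝ} (hS : S.IsHermitian)
    (v : EuclideanSpace ℝ (Fin d)) :
    ⟪v, Matrix.toEuclideanLin S v⟫ = ∑ i, hS.eigenvalues i * ⟪hS.eigenvectorBasis i, v⟫ ^ 2 := by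
  rw [← hS.eigenvectorBasis.sum_inner_mul_inner]
  refine Finset.sum_congr rfl fun i _ => ?_
  have h1 : Matrix.toEuclideanLin Sᵀ (hS.eigenvectorBasis i)
      = hS.eigenvalues i • hS.eigenvectorBasis i := by
    rw [← Matrix.conjTranspose_eq_transpose_of_trivial, hS.eq]
    ext j
    simpa using congrFun (hS.mulVec_eigenvectorBasis i) j
  have h2 : ⟪hS.eigenvectorBasis i, Matrix.toEuclideanLin S v⟫
      = hS.eigenvalues i * ⟪hS.eigenvectorBasis i, v⟫ := by
    rw [real_inner_comm, inner_toEuclideanLin_left, h1, inner_smul_right, real_inner_comm]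
  rw [h2, real_inner_comm]
  ring

lemma lambdaMin_mul_norm_sq_le {S : Matrix (Fin d) (Fin d) ℝ} (hS : S.IsHermitian)
    (v : EuclideanSpace ℝ (Fin d)) :
    lambdaMin S * ‖v‖ ^ 2 ≤ ⟪v, Matrix.toEuclideanLin S v⟫ := by
  rw [inner_toEuclideanLin_eq_sum hS, ← hS.eigenvectorBasis.sum_sq_inner_right, Finset.mul_sum]
  refine Finset.sum_le_sum fun i _ => ?_
  have : lambdaMin S ≤ hS.eigenvalues i := by
    rw [lambdaMin, hS.spectrum_real_eq_range_eigenvalues]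
    exact csInf_le (Set.finite_range _).bddBelow ⟨i, rfl⟩
  gcongr

lemma le_lambdaMin (hd : 0 < d) {S : Matrix (Fin d) (Fin d) ℝ} (hS : S.IsHermitian) {c : ℝ}
    (h : ∀ v, c * ‖v‖ ^ 2 ≤ ⟪v, Matrix.toEuclideanLin S v⟫) : c ≤ lambdaMin S := by
  have : Nonempty (Fin d) := ⟨⟨0, hd⟩⟩
  rw [lambdaMin, hS.spectrum_real_eq_range_eigenvalues]
  refine le_csInf (Set.range_nonempty _) ?_
  rintro _ ⟨i, rfl⟩
  have h1 := h (hS.eigenvectorBasis i)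
  rw [inner_toEuclideanLin_eq_sum hS] at h1
  simpa [hS.eigenvectorBasis.inner_eq_ite] using h1

lemma lambdaMin_pos (hd : 0 < d) {S : Matrix (Fin d) (Fin d) ℝ} (hS : S.PosDef) :
    0 < lambdaMin S := by
  have : Nonempty (Fin d) := ⟨⟨0, hd⟩⟩
  have hmem : lambdaMin S ∈ Set.range hS.isHermitian.eigenvalues := by
    rw [lambdaMin, hS.isHermitian.spectrum_real_eq_range_eigenvalues]
    exact (Set.range_nonempty _).csInf_mem (Set.finite_range _)
  obtain ⟨i, hi⟩ := hmem
  rw [← hi]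
  exact hS.eigenvalues_pos i

end LambdaMin

/-! ### Risk bound on the good event -/

section Deterministic

variable {n dx dy : ℕ}

lemma isHermitian_empCov (X : Matrix (Fin n) (Fin dx) ℝ) : (empCov X).IsHermitian := by
  have := (Matrix.isHermitian_conjTranspose_mul_self X)
  rw [Matrix.conjTranspose_eq_transpose_of_trivial] at this
  rw [empCov, Matrix.IsHermitian, Matrix.conjTranspose_smul, this.eq]
  simp

lemma inner_empCov (X : Matrix (Fin n) (Fin dx) ℝ) (v : EuclideanSpace ℝ (Fin dx)) :
    ⟪v, Matrix.toEuclideanLin (empCov X) v⟫ = 1 / n * ‖Matrix.toEuclideanLin X v‖ ^ 2 := by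
  rw [empCov, map_smul, LinearMap.smul_apply, inner_smul_right, norm_sq_toEuclideanLin_eq_inner]

lemma lse_sub_eq {X : Matrix (Fin n) (Fin dx) ℝ} (hX : (Xᵀ * X).det ≠ 0)
    (A : Matrix (Fin dy) (Fin dx) ℝ) (N : Matrix (Fin n) (Fin dy) ℝ) :
    lse X (X * Aᵀ + N) - A = Nᵀ * X * (Xᵀ * X)⁻¹ := by
  have h : A * (Xᵀ * X) * (Xᵀ * X)⁻¹ = A := by
    rw [Matrix.mul_assoc, Matrix.mul_nonsing_inv _ (isUnit_iff_ne_zero.2 hX), Matrix.mul_one]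
  rw [lse, Matrix.transpose_add, Matrix.transpose_mul, Matrix.transpose_transpose, Matrix.add_mul,
    Matrix.add_mul, Matrix.mul_assoc A, h, add_sub_cancel_left]

/-- For `w = (Xᵀ X)⁻¹ v` one has `‖X w‖² = ⟪w, v⟫`, and `X` is bounded below by `s`; so `‖X w‖ ≤ ‖v‖
/ s`. Measuring the noise against `‖X w‖` thus costs a single factor `1 / s`. -/
lemma norm_lse_error_le {X : Matrix (Fin n) (Fin dx) ℝ} (hX : (Xᵀ * X).det ≠ 0) (hn : 0 < n)
    (hpos : 0 < lambdaMin (empCov X)) {N : Matrix (Fin n) (Fin dy) ℝ} {b : ℝ} (hb : 0 ≤ b)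
    (hN : ∀ w, ‖Matrix.toEuclideanLin (Nᵀ * X) w‖ ≤ b * ‖Matrix.toEuclideanLin X w‖)
    (v : EuclideanSpace ℝ (Fin dx)) :
    ‖Matrix.toEuclideanLin (Nᵀ * X * (Xᵀ * X)⁻¹) v‖ ≤ b / √(n * lambdaMin (empCov X)) * ‖v‖ := by
  have hn' : (0 : ℝ) < n := by exact_mod_cast hn
  set w := Matrix.toEuclideanLin (Xᵀ * X)⁻¹ v with hw
  set s := √((n : ℝ) * lambdaMin (empCov X)) with hs
  have hs0 : 0 < s := Real.sqrt_pos.2 (by positivity)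
  have h1 : s * ‖w‖ ≤ ‖Matrix.toEuclideanLin X w‖ := by
    refine le_of_sq_le_sq ?_ (norm_nonneg _)
    have h2 := lambdaMin_mul_norm_sq_le (isHermitian_empCov X) w
    rw [inner_empCov, one_div, ← div_eq_inv_mul, le_div_iff₀ hn'] at h2
    rw [mul_pow, hs, Real.sq_sqrt (by positivity)]
    linarith
  have h3 : ‖Matrix.toEuclideanLin X w‖ ^ 2 ≤ ‖w‖ * ‖v‖ := by
    rw [norm_sq_toEuclideanLin_eq_inner, hw, ← toEuclideanLin_mul_apply (Xᵀ * X),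
      Matrix.mul_nonsing_inv _ (isUnit_iff_ne_zero.2 hX), toEuclideanLin_one_apply]
    exact real_inner_le_norm _ _
  have h4 : s * ‖Matrix.toEuclideanLin X w‖ ≤ ‖v‖ := by
    rcases (norm_nonneg (Matrix.toEuclideanLin X w)).eq_or_lt with h0 | h0
    · rw [← h0, mul_zero]; exact norm_nonneg _
    · refine le_of_mul_le_mul_right ?_ h0
      calc s * ‖Matrix.toEuclideanLin X w‖ * ‖Matrix.toEuclideanLin X w‖
          = s * ‖Matrix.toEuclideanLin X w‖ ^ 2 := by ring
        _ ≤ s * (‖w‖ * ‖v‖) := by gcongr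
        _ = s * ‖w‖ * ‖v‖ := by ring
        _ ≤ ‖Matrix.toEuclideanLin X w‖ * ‖v‖ := by gcongr
        _ = ‖v‖ * ‖Matrix.toEuclideanLin X w‖ := by ring
  rw [toEuclideanLin_mul_apply, ← hw]
  calc ‖Matrix.toEuclideanLin (Nᵀ * X) w‖ ≤ b * ‖Matrix.toEuclideanLin X w‖ := hN w
    _ ≤ b * (‖v‖ / s) := by
        gcongr
        rw [le_div_iff₀ hs0]
        linarith
    _ = b / s * ‖v‖ := by ring

/-- The risk bound on the event where the design is well conditioned and the projected noise is
small. -/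
lemma norm_tlse_sub_sq_le (hdx : 0 < dx) (hn : 0 < n) {σ δ : ℝ} (hσ : 0 < σ)
    (hδ : δ ∈ Set.Ioo (0 : ℝ) 1) {B : Matrix (Fin dx) (Fin dx) ℝ} (hB : (Bᵀ * B).PosDef)
    (A : Matrix (Fin dy) (Fin dx) ℝ) {X : Matrix (Fin n) (Fin dx) ℝ}
    {N : Matrix (Fin n) (Fin dy) ℝ} (hX : (Xᵀ * X).det ≠ 0)
    (hlow : ∀ w, 1 / 5 * √n * ‖Matrix.toEuclideanLin B w‖ ≤ ‖Matrix.toEuclideanLin X w‖)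
    (hN : ∀ w, ‖Matrix.toEuclideanLin (Nᵀ * X) w‖
      ≤ σ * (19 / 10 * (√dx + √dy + √(Real.log (1 / δ)))) * ‖Matrix.toEuclideanLin X w‖)
    (k : ℕ) :
    ‖tlse σ δ X (X * Aᵀ + N) - A‖ ^ 2 ≤ 9000000 * riskBound n σ δ (Bᵀ * B) A k := by
  have hn' : (0 : ℝ) < n := by exact_mod_cast hn
  have hL := log_one_div_nonneg hδ
  have hlam := lambdaMin_pos hdx hB
  have hemp : lambdaMin (Bᵀ * B) / 25 ≤ lambdaMin (empCov X) := by
    refine le_lambdaMin hdx (isHermitian_empCov X) fun v => ?_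
    have h1 := lambdaMin_mul_norm_sq_le hB.isHermitian v
    rw [← norm_sq_toEuclideanLin_eq_inner] at h1
    have h2 : (1 / 5 * √n * ‖Matrix.toEuclideanLin B v‖) ^ 2 ≤ ‖Matrix.toEuclideanLin X v‖ ^ 2 := by
      gcongr
      exact hlow v
    rw [mul_pow, mul_pow, Real.sq_sqrt hn'.le] at h2
    rw [inner_empCov, one_div, ← div_eq_inv_mul, le_div_iff₀ hn']
    nlinarith
  have hpos : 0 < lambdaMin (empCov X) := lt_of_lt_of_le (by positivity) hemp
  set β := √(dx : ℝ) + √(dy : ℝ) + √(Real.log (1 / δ)) with hβ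
  have hβ0 : 0 ≤ β := by positivity
  have hE := norm_lse_error_le hX hn hpos (b := σ * (19 / 10 * β)) (by positivity) hN
  rw [← lse_sub_eq hX A N] at hE
  have hξ : threshold σ δ dy X = 2 * σ * β / √(n * lambdaMin (empCov X)) := rfl
  have hmain := norm_svThreshold_sub_sq_le (lse X (X * Aᵀ + N)) A
    (ξ := threshold σ δ dy X) (by positivity) (by rw [hξ]; positivity)
    (by rw [hξ]; apply le_of_eq; ring) hE k
  have hβ2 : β ^ 2 ≤ 3 * (dx + dy + Real.log (1 / δ)) := by
    have h1 := Real.sq_sqrt (show (0 : ℝ) ≤ dx by positivity)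
    have h2 := Real.sq_sqrt (show (0 : ℝ) ≤ dy by positivity)
    have h3 := Real.sq_sqrt hL
    rw [hβ]
    nlinarith [sq_nonneg (√(dx : ℝ) - √(dy : ℝ)), sq_nonneg (√(dx : ℝ) - √(Real.log (1 / δ))),
      sq_nonneg (√(dy : ℝ) - √(Real.log (1 / δ)))]
  -- `300 = 4 * 3 * 25`: the squared factor of the threshold, `hβ2` and `hemp`. With the `30000` of
  -- the oracle inequality it gives `9000000`.
  have hξ2 : threshold σ δ dy X ^ 2 ≤
      300 * (σ ^ 2 * (dx + dy + Real.log (1 / δ)) / (n * lambdaMin (Bᵀ * B))) := by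
    rw [hξ, div_pow, Real.sq_sqrt (by positivity)]
    calc (2 * σ * β) ^ 2 / (n * lambdaMin (empCov X))
        = 4 * σ ^ 2 * β ^ 2 / (n * lambdaMin (empCov X)) := by ring
      _ ≤ 4 * σ ^ 2 * (3 * (dx + dy + Real.log (1 / δ))) / (n * (lambdaMin (Bᵀ * B) / 25)) := by
          gcongr
      _ = _ := by field_simp; ring
  have hR : 0 ≤ ∑ i ∈ Finset.Ico k (min dx dy), sval A i ^ 2 :=
    Finset.sum_nonneg fun i _ => sq_nonneg _
  have hk : (k : ℝ) * threshold σ δ dy X ^ 2 ≤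
      k * (300 * (σ ^ 2 * (dx + dy + Real.log (1 / δ)) / (n * lambdaMin (Bᵀ * B)))) := by
    gcongr
  refine hmain.trans ?_
  have e : (k : ℝ) * σ ^ 2 * ((dx : ℝ) + (dy : ℝ) + Real.log (1 / δ)) / (n * lambdaMin (Bᵀ * B))
      = k * (σ ^ 2 * (dx + dy + Real.log (1 / δ)) / (n * lambdaMin (Bᵀ * B))) := by ring
  rw [riskBound, e]
  linarith

lemma det_ne_zero_of_lower_bound {n d : ℕ} (hn : 0 < n) {B : Matrix (Fin d) (Fin d) ℝ}
    (hB : IsUnit B.det) {X : Matrix (Fin n) (Fin d) ℝ}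
    (hlow : ∀ w, 1 / 5 * √n * ‖Matrix.toEuclideanLin B w‖ ≤ ‖Matrix.toEuclideanLin X w‖) :
    (Xᵀ * X).det ≠ 0 := by
  intro h0
  obtain ⟨v, hv, hXv⟩ := Matrix.exists_mulVec_eq_zero_iff.2 h0
  have h1 : Matrix.toEuclideanLin X (WithLp.toLp 2 v) = 0 := by
    rw [← norm_eq_zero, ← sq_eq_zero_iff, norm_sq_toEuclideanLin_eq_inner,
      Matrix.toLpLin_toLp, Matrix.toLin'_apply, hXv]
    simp
  have h2 := hlow (WithLp.toLp 2 v)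
  rw [h1, norm_zero] at h2
  have hn' : (0 : ℝ) < √n := Real.sqrt_pos.2 (by exact_mod_cast hn)
  have h3 : ‖Matrix.toEuclideanLin B (WithLp.toLp 2 v)‖ = 0 :=
    le_antisymm (by
      by_contra! hlt
      have : 0 < 1 / 5 * √n * ‖Matrix.toEuclideanLin B (WithLp.toLp 2 v)‖ := by positivity
      linarith) (norm_nonneg _)
  rw [norm_eq_zero, Matrix.toLpLin_toLp, Matrix.toLin'_apply] at h3
  exact hv (Matrix.eq_zero_of_mulVec_eq_zero (isUnit_iff_ne_zero.1 hB) (by simpa using h3))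

end Deterministic

end TLSE

/-! ### Assembly of the two events -/

theorem mainTheorem3 :
    ∃ c C : ℝ, 0 < c ∧ 0 < C ∧
      ∀ (Ω : Type*) [MeasurableSpace Ω] (P : Measure Ω) [IsProbabilityMeasure P]
        (n dx dy r : ℕ) (_hdx : 0 < dx) (_hdy : 0 < dy)
        (A : Matrix (Fin dy) (Fin dx) ℝ) (_hr : A.rank ≤ r)
        (S : Matrix (Fin dx) (Fin dx) ℝ) (_hS : S.PosDef)
        (σ : ℝ) (_hσ : 0 < σ) (δ : ℝ) (_hδ : δ ∈ Set.Ioo (0 : ℝ) 1)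
        (x : Fin n → Ω → EuclideanSpace ℝ (Fin dx))
        (η y : Fin n → Ω → EuclideanSpace ℝ (Fin dy))
        (_hx : ∀ i, HasLaw (x i) (multivariateGaussian 0 S) P)
        (_hη : ∀ i, HasLaw (η i)
          (multivariateGaussian 0 (σ ^ 2 • (1 : Matrix (Fin dy) (Fin dy) ℝ))) P)
        (_hxi : iIndepFun x P) (_hηi : iIndepFun η P)
        (_hxη : IndepFun (fun ω i => x i ω) (fun ω i => η i ω) P)
        (_hy : ∀ i ω, y i ω = Matrix.toEuclideanLin A (x i ω) + η i ω)
        (_hn : c * ((dx : ℝ) + Real.log (1 / δ)) ≤ (n : ℝ)),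
        ENNReal.ofReal (1 - δ) ≤
          P {ω | ‖TLSE.tlse σ δ (TLSE.dataMatrix fun i => x i ω)
                    (TLSE.dataMatrix fun i => y i ω) - A‖ ^ 2 ≤
              C * (Finset.range (r + 1)).inf' Finset.nonempty_range_add_one
                (TLSE.riskBound n σ δ S A)} := by
  refine ⟨1000, 9000000, by norm_num, by norm_num, ?_⟩
  intro Ω _ P _ n dx dy r hdx hdy A _ S hS σ hσ δ hδ x η y hx hη hxi hηi hxη hy hn
  obtain ⟨B, hB, rfl⟩ := TLSE.exists_isUnit_transpose_mul_self_eq hS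
  have hn0 : 0 < n := by
    have h1 := TLSE.log_one_div_nonneg hδ
    have h2 : (1 : ℝ) ≤ dx := by exact_mod_cast hdx
    have h3 : (0 : ℝ) < n := by linarith
    exact_mod_cast h3
  set T : Set Ω := {ω | ‖TLSE.tlse σ δ (TLSE.dataMatrix fun i => x i ω)
      (TLSE.dataMatrix fun i => y i ω) - A‖ ^ 2 ≤
        9000000 * (Finset.range (r + 1)).inf' Finset.nonempty_range_add_one
          (TLSE.riskBound n σ δ (Bᵀ * B) A)} with hT
  have hbad₁ := (TLSE.design_real_not_le_norm_le hB hx hxi).trans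
    (TLSE.two_mul_five_pow_mul_exp_le hdx hδ hn)
  have hbad₂ := TLSE.noise_real_not_le_of_indepFun hdx hdy hσ hη hηi hδ
    (fun i => (hx i).aemeasurable) hxη
  set E₁ : Set Ω := {ω | ¬ ∀ w, 1 / 5 * √n * ‖Matrix.toEuclideanLin B w‖
    ≤ ‖Matrix.toEuclideanLin (TLSE.dataMatrix fun i => x i ω) w‖}
  set E₂ : Set Ω := {ω | ((TLSE.dataMatrix fun i => x i ω)ᵀ *
      TLSE.dataMatrix fun i => x i ω).det ≠ 0 ∧
      ¬ ∀ w, ‖Matrix.toEuclideanLin ((TLSE.dataMatrix fun i => η i ω)ᵀ *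
          TLSE.dataMatrix fun i => x i ω) w‖
        ≤ σ * (19 / 10 * (√dx + √dy + √(Real.log (1 / δ)))) *
          ‖Matrix.toEuclideanLin (TLSE.dataMatrix fun i => x i ω) w‖}
  -- Covering the space needs only subadditivity, so `T` need not be shown measurable.
  have hcover : (Set.univ : Set Ω) ⊆ T ∪ (E₁ ∪ E₂) := by
    intro ω _
    by_contra hω
    simp only [Set.mem_union, not_or] at hω
    obtain ⟨hωT, hω₁, hω₂⟩ := hω
    have hlow := not_not.1 hω₁
    have hdet := TLSE.det_ne_zero_of_lower_bound hn0 hB hlow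
    have hN := not_not.1 fun h => hω₂ ⟨hdet, h⟩
    apply hωT
    have hY : (TLSE.dataMatrix fun i => y i ω) = (TLSE.dataMatrix fun i => x i ω) * Aᵀ +
        TLSE.dataMatrix fun i => η i ω := by
      ext i j
      simp [TLSE.dataMatrix, hy, Matrix.mul_apply, Matrix.toLpLin_apply, Matrix.mulVec, dotProduct,
        mul_comm]
    -- The good event does not depend on `k`, so the bound may be used at the minimiser.
    obtain ⟨k, _, hk⟩ := Finset.exists_mem_eq_inf' (Finset.nonempty_range_add_one (n := r))
      (TLSE.riskBound n σ δ (Bᵀ * B) A)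
    simp only [hT, Set.mem_ofPred_eq]
    rw [hk, hY]
    exact TLSE.norm_tlse_sub_sq_le hdx hn0 hσ hδ hS A hdet hlow hN k
  have h1 : (1 : ℝ) ≤ P.real T + (P.real E₁ + P.real E₂) := by
    calc (1 : ℝ) = P.real Set.univ := by simp
      _ ≤ P.real (T ∪ (E₁ ∪ E₂)) := measureReal_mono hcover (measure_ne_top _ _)
      _ ≤ P.real T + P.real (E₁ ∪ E₂) := measureReal_union_le _ _
      _ ≤ _ := by gcongr; exact measureReal_union_le _ _
  rw [ENNReal.ofReal_le_iff_le_toReal (measure_ne_top _ _)]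
  change _ ≤ P.real T
  linarith
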